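/- Let $\mathbb K\in\{\mathbb R,\mathbb C\}$. **Saks spaces.** A Saks space $(X,\|\cdot\|_X,\tau_X)$ is a Banach space over $\mathbb K$ with a Hausdorff locally convex topology $\tau_X$, coarser than the norm topology, such that $\|x\|_X=\sup\{|x'(x)| : x'\in(X,\tau_X)',\ |x'(y)|\le\|y\|_X\ \forall y\in X\}$ for all $x\in X$. Its mixed topology $\gamma_X$ is the finest linear topology on $X$ with $\tau_X\subseteq\gamma_X\subseteq\tau_{\|\cdot\|_X}$ that coincides with $\tau_X$ on $\|\cdot\|_X$-bounded sets, and $X_\gamma'=(X,\gamma_X)'$. The Saks space is sequentially complete if every $\gamma_X$-Cauchy sequence is $\gamma_X$-convergent, and C-sequential if every convex sequentially open subset of $(X,\gamma_X)$ is open. $X^\circ$ is the space of all $x'\in(X,\|\cdot\|_X)'$ that are $\tau_X$-sequentially continuous on $\|\cdot\|_X$-bounded sets. **Semigroups.** A semigroup $(S_t)_{t\ge0}$ of bounded linear operators on $X$ is locally $\tau_X$-bi-continuous if there are $M\ge1$, $\omega\in\mathbb R$ with $\|S_t\|\le Me^{\omega t}$ for all $t\geq 0$; $t\mapsto S_tx$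 is $\tau_X$-continuous on $[0,\infty)$ for every $x\in X$; and for every $\|\cdot\|_X$-bounded sequence $(x_n)$ with $\tau_X$-limit $x$ one has $S_t(x_n-x)\to0$ in $\tau_X$, uniformly for $t$ in compact subsets of $[0,\infty)$. **Control functions.** For a Saks space $(U,\|\cdot\|_U,\tau_U)$ and $T>0$, $C_{\tau,b}([0,T];U)$ is the space of $\tau_U$-continuous, $\|\cdot\|_U$-bounded functions $[0,T]\to U$, and $\gamma_\infty$ is the locally convex topology on it given by the seminorms $f\mapsto\sup_{t\in[0,T]}p(f(t))$, where $p$ runs through the $\gamma_U$-continuous seminorms on $U$. **Vector measures.** For a locally convex topology $\vartheta$ on $U$, $M([0,T];(U,\vartheta)')$ is the set of finitely additive maps $\nu$ from the Borel sets of $[0,T]$ to $(U,\vartheta)'$ such that (i) $\nu(\cdot)u$ is a ($\sigma$-additive, finite) $\mathbb K$-valued Borel measure for all $u\in U$, and (ii) there are a $\vartheta$-continuous seminorm $p$ on $U$ and $C\ge0$ with $|\sum_{i=1}^n\nu(N_i)u_i|\le C$ for all finite Borel partitions $N_1,\dots,N_n$ of $[0,T]$ and all $u_1,\dots,u_n\in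 U$ with $p(u_i)\le1$. We write $M([0,T];U_\gamma')$ for $\vartheta=\gamma_U$. The semivariation norm is $\|\nu\|_{var}=\sup|\sum_{i=1}^n\nu(N_i)u_i|$ over all finite Borel partitions $(N_i)$ of $[0,T]$ and all $u_i\in U$ with $\|u_i\|_U\le1$. The integral $\int_0^Tu(t)\,d\nu$ is the limit of the sums $\sum_i\nu(N_i)u(t_i)$, $t_i\in N_i$, over finite Borel partitions directed by refinement, and $\Theta_\gamma(\nu)(u)=\int_0^Tu(t)\,d\nu$ for $\nu\in M([0,T];U_\gamma')$, $u\in C_{\tau,b}([0,T];U)$. **Theorem.** Let $(X,\|\cdot\|_X,\tau_X)$ be a sequentially complete C-sequential Saks space, $(U,\|\cdot\|_U,\tau_U)$ a Saks space over the same field, $(S_t)_{t\ge0}$ a locally $\tau_X$-bi-continuous semigroup on $X$, and $B\colon U\to X$ a bounded linear operator that is also $\tau_U$-$\tau_X$-continuous on $\|\cdot\|_U$-bounded sets. Let $T>0$. For $u\in C_{\tau,b}([0,T];U)$ the function $t\mapsto S_{T-t}Bu(t)$ is Pettis integrable in $(X,\gamma_X)$; put $$\mathcal B^Tu=\int_0^TS_{T-t}Bu(t)\,dt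 .$$ For $x^\circ\in X^\circ$ put $\langle(\mathcal B^T)^\circ x^\circ,u\rangle=\langle x^\circ,\mathcal B^Tu\rangle$, $S_t^\circ x^\circ=S_t'x^\circ$, $B^\circ x^\circ=B'x^\circ$, and, with $\lambda$ the Lebesgue measure, $$(B^\circ S^\circ_{(\cdot)}x^\circ\odot\lambda)(N)u=\int_N\langle B^\circ S_t^\circ x^\circ,u\rangle\,dt,\qquad (B^\circ S^\circ_{T-(\cdot)}x^\circ\odot\lambda)(N)u=\int_N\langle B^\circ S_{T-t}^\circ x^\circ,u\rangle\,dt$$ for Borel sets $N\subseteq[0,T]$ and $u\in U$, where the integrands are integrable. Then for every $x^\circ\in X^\circ$: 1. $B^\circ S^\circ_{(\cdot)}x^\circ\odot\lambda$ and $B^\circ S^\circ_{T-(\cdot)}x^\circ\odot\lambda$ belong to $M([0,T];U_\gamma')$. 2. $(\mathcal B^T)^\circ x^\circ\in(C_{\tau,b}([0,T];U),\gamma_\infty)'$ and $(\mathcal B^T)^\circ x^\circ=\Theta_\gamma(B^\circ S^\circ_{T-(\cdot)}x^\circ\odot\lambda)$; that is, for every $u\in C_{\tau,b}([0,T];U)$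 the integral of $u$ against this measure exists and equals $\langle(\mathcal B^T)^\circ x^\circ,u\rangle$. 3. The restriction of $(\mathcal B^T)^\circ x^\circ$ to $C([0,T];(U,\|\cdot\|_U))$ is a bounded linear functional for the sup norm $\|\cdot\|_\infty$, and $$\|(\mathcal B^T)^\circ x^\circ\|_{(C([0,T];(U,\|\cdot\|_U)),\|\cdot\|_\infty)'}=\|B^\circ S^\circ_{(\cdot)}x^\circ\odot\lambda\|_{var}.$$ -/

import Mathlib

open Set Filter Topology MeasureTheory
open scoped ENNReal

noncomputable section

namespace BiCont

section Saks

variable (𝕜 : Type*) [RCLike 𝕜] (X : Type*) [NormedAddCommGroup X] [NormedSpace 𝕜 X]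
  [NormedSpace ℝ X]

/-- A Saks topology on a normed space `X` (which is assumed complete wherever this is used): a
Hausdorff locally convex topology `τ`, coarser than the norm topology, whose dual is norming,
i.e. `‖x‖ = sup {|x'(x)| : x' ∈ (X, τ)', ‖x'‖ ≤ 1}`. -/
structure SaksTopology where
  /-- the topology `τ` -/
  top : TopologicalSpace X
  isTopologicalAddGroup : @IsTopologicalAddGroup X top _
  continuousSMul : @ContinuousSMul 𝕜 X _ _ top
  locallyConvex : @LocallyConvexSpace ℝ X _ _ _ _ top
  t2 : @T2Space X top
  norm_le : (UniformSpace.toTopologicalSpace : TopologicalSpace X) ≤ top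
  norming : ∀ x : X,
    IsLUB {r : ℝ | ∃ x' : X →ₗ[𝕜] 𝕜,
      @Continuous X 𝕜 top _ x' ∧ (∀ y, ‖x' y‖ ≤ ‖y‖) ∧ r = ‖x' x‖} ‖x‖

variable {𝕜 X}

/-- Two topologies coincide on all norm-bounded sets. -/
def CoincideOnBounded (t₁ t₂ : TopologicalSpace X) : Prop :=
  ∀ s : Set X, Bornology.IsBounded s →
    t₁.induced (Subtype.val : s → X) = t₂.induced (Subtype.val : s → X)

/-- The linear topologies `t` on `X` with `τ ⊆ t ⊆ τ_‖·‖` that coincide with `τ` on norm-bounded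
sets. -/
def mixedCandidates (τ : SaksTopology 𝕜 X) : Set (TopologicalSpace X) :=
  {t | @IsTopologicalAddGroup X t _ ∧ @ContinuousSMul 𝕜 X _ _ t ∧
    (UniformSpace.toTopologicalSpace : TopologicalSpace X) ≤ t ∧ t ≤ τ.top ∧
    CoincideOnBounded t τ.top}

/-- The mixed topology `γ(‖·‖, τ)`: the finest of the candidate topologies. (In Mathlib's order on
topologies finer means smaller, and the infimum of the candidates is again one of them, see
`mixed_mem_mixedCandidates`.) -/
abbrev SaksTopology.mixed (τ : SaksTopology 𝕜 X) : TopologicalSpace X :=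
  sInf (mixedCandidates τ)

theorem top_mem_mixedCandidates (τ : SaksTopology 𝕜 X) : τ.top ∈ mixedCandidates τ :=
  ⟨τ.isTopologicalAddGroup, τ.continuousSMul, τ.norm_le, le_rfl, fun _ _ => rfl⟩

theorem norm_le_mixed (τ : SaksTopology 𝕜 X) :
    (UniformSpace.toTopologicalSpace : TopologicalSpace X) ≤ τ.mixed :=
  le_sInf fun _ ht => ht.2.2.1

theorem mixed_mem_mixedCandidates (τ : SaksTopology 𝕜 X) : τ.mixed ∈ mixedCandidates τ := by
  refine ⟨topologicalAddGroup_sInf fun t ht => ht.1, continuousSMul_sInf fun t ht => ht.2.1,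
    norm_le_mixed τ, sInf_le (top_mem_mixedCandidates τ), fun s hs => ?_⟩
  refine le_antisymm (induced_mono (sInf_le (top_mem_mixedCandidates τ))) ?_
  rw [SaksTopology.mixed, sInf_eq_iInf, induced_iInf]
  refine le_iInf fun t => ?_
  rw [induced_iInf]
  exact le_iInf fun ht => (ht.2.2.2.2 s hs).ge

/-- `(X, γ)` is sequentially complete: every `γ`-Cauchy sequence is `γ`-convergent. -/
def SaksTopology.SeqComplete (τ : SaksTopology 𝕜 X) : Prop :=
  ∀ x : ℕ → X, (∀ V ∈ @nhds X τ.mixed 0, ∃ n₀, ∀ m ≥ n₀, ∀ n ≥ n₀, x m - x n ∈ V) →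
    ∃ y, Tendsto x atTop (@nhds X τ.mixed y)

/-- `(X, γ)` is C-sequential: every convex sequentially open set is open. -/
def SaksTopology.CSequential (τ : SaksTopology 𝕜 X) : Prop :=
  ∀ s : Set X, Convex ℝ s →
    (∀ (x : ℕ → X) (y : X), y ∈ s → Tendsto x atTop (@nhds X τ.mixed y) → ∀ᶠ n in atTop, x n ∈ s) →
    @IsOpen X τ.mixed s

/-- The space `X°` of all norm-continuous linear functionals that are `τ`-sequentially continuous on
norm-bounded sets. -/
def SaksTopology.sunDual (τ : SaksTopology 𝕜 X) : Submodule 𝕜 (StrongDual 𝕜 X) where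
  carrier := {x' | ∀ (x : ℕ → X) (y : X), Bornology.IsBounded (range x) →
    Tendsto x atTop (@nhds X τ.top y) → Tendsto (fun n => x' (x n)) atTop (𝓝 (x' y))}
  add_mem' := fun h₁ h₂ x y hx hy => (h₁ x y hx hy).add (h₂ x y hx hy)
  zero_mem' := fun _ _ _ _ => tendsto_const_nhds
  smul_mem' := fun c _ h x y hx hy => (h x y hx hy).const_smul c

/-- `(S_t)_{t ≥ 0}` is a locally `τ`-bi-continuous semigroup; only the values at `t ≥ 0` matter. -/
structure IsLocallyBiContinuous (τ : SaksTopology 𝕜 X) (S : ℝ → X →L[𝕜] X) : Prop where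
  map_zero : S 0 = ContinuousLinearMap.id 𝕜 X
  map_add : ∀ s t, 0 ≤ s → 0 ≤ t → S (s + t) = (S s).comp (S t)
  exp_bounded : ∃ M ω : ℝ, 1 ≤ M ∧ ∀ t, 0 ≤ t → ‖S t‖ ≤ M * Real.exp (ω * t)
  continuous : ∀ x : X, @ContinuousOn ℝ X _ τ.top (fun t => S t x) (Ici 0)
  bi_equicontinuous : ∀ (x : ℕ → X) (y : X), Bornology.IsBounded (range x) →
    Tendsto x atTop (@nhds X τ.top y) → ∀ t₀ : ℝ, ∀ V ∈ @nhds X τ.top 0,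
      ∀ᶠ n in atTop, ∀ t ∈ Icc 0 t₀, S t (x n - y) ∈ V

end Saks

section Operators

variable {𝕜 : Type*} [RCLike 𝕜] {X : Type*} [NormedAddCommGroup X] [NormedSpace 𝕜 X]
  [NormedSpace ℝ X] {U : Type*} [NormedAddCommGroup U] [NormedSpace 𝕜 U] [NormedSpace ℝ U]

/-- `B` is `τ_U`-`τ_X`-continuous on norm-bounded sets. -/
def ContinuousOnBounded (τU : SaksTopology 𝕜 U) (τX : SaksTopology 𝕜 X) (B : U →L[𝕜] X) : Prop :=
  ∀ s : Set U, Bornology.IsBounded s → @ContinuousOn U X τU.top τX.top B s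

/-- The dual operator `A'`, `⟨A' x', u⟩ = ⟨x', A u⟩`. The operators `B°` and `S°_t` are the
restrictions of `B'` and `S_t'` to `X°`. -/
def dualOp (A : U →L[𝕜] X) : StrongDual 𝕜 X →L[𝕜] StrongDual 𝕜 U :=
  ContinuousLinearMap.precomp 𝕜 A

end Operators

section Pettis

variable (𝕜 : Type*) [RCLike 𝕜] {X : Type*} [AddCommGroup X] [Module 𝕜 X]
  {Ω : Type*} [MeasurableSpace Ω]

/-- `f` is Pettis integrable in `(X, ϑ)` with respect to `μ`, and its integral over `Ω` is `x`. -/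
structure HasPettisIntegral (ϑ : TopologicalSpace X) (μ : Measure Ω) (f : Ω → X) (x : X) :
    Prop where
  integrable : ∀ x' : X →ₗ[𝕜] 𝕜, @Continuous X 𝕜 ϑ _ x' → Integrable (fun t => x' (f t)) μ
  exists_setIntegral : ∀ N : Set Ω, MeasurableSet N → ∃ y : X, ∀ x' : X →ₗ[𝕜] 𝕜,
    @Continuous X 𝕜 ϑ _ x' → x' y = ∫ t in N, x' (f t) ∂μ
  apply_eq : ∀ x' : X →ₗ[𝕜] 𝕜, @Continuous X 𝕜 ϑ _ x' → x' x = ∫ t, x' (f t) ∂μ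

open Classical in
/-- The Pettis integral of `f` over `Ω` (and `0` if `f` is not Pettis integrable). -/
def pettisIntegral (ϑ : TopologicalSpace X) (μ : Measure Ω) (f : Ω → X) : X :=
  if h : ∃ x, HasPettisIntegral 𝕜 ϑ μ f x then h.choose else 0

end Pettis

section ControlSpace

variable {𝕜 : Type*} [RCLike 𝕜] {U : Type*} [NormedAddCommGroup U] [NormedSpace 𝕜 U]
  [NormedSpace ℝ U]

/-- The space `C_{τ,b}([0,T];U)` of norm-bounded `τ`-continuous functions. -/
def Ctb (τ : SaksTopology 𝕜 U) (T : ℝ) : Submodule 𝕜 (Icc (0 : ℝ) T → U) where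
  carrier := {f | @Continuous _ U _ τ.top f ∧ ∃ C : ℝ, ∀ t, ‖f t‖ ≤ C}
  add_mem' := by
    rintro f g ⟨hf, C, hC⟩ ⟨hg, D, hD⟩
    let _ := τ.top
    have := τ.isTopologicalAddGroup
    exact ⟨Continuous.add hf hg, C + D, fun t => (norm_add_le _ _).trans (add_le_add (hC t) (hD t))⟩
  zero_mem' := ⟨@continuous_const _ U _ τ.top 0, 0, fun t => by simp⟩
  smul_mem' := by
    rintro c f ⟨hf, C, hC⟩
    refine ⟨?_, ‖c‖ * C, fun t => ?_⟩
    · let _ := τ.top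
      have := τ.continuousSMul
      exact Continuous.const_smul hf c
    · rw [Pi.smul_apply, norm_smul]
      exact mul_le_mul_of_nonneg_left (hC t) (norm_nonneg c)

/-- The inclusion of `C([0,T];(U,‖·‖))` into `C_{τ,b}([0,T];U)`. -/
def Ctb.ofContinuousMap (τ : SaksTopology 𝕜 U) {T : ℝ} (f : C(Icc (0 : ℝ) T, U)) : Ctb τ T :=
  ⟨f, continuous_le_rng τ.norm_le f.continuous, ‖f‖, f.norm_coe_le_norm⟩

theorem bddAbove_seminorm (τ : SaksTopology 𝕜 U) {T : ℝ} (p : Seminorm 𝕜 U)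
    (hp : @Continuous U ℝ τ.mixed _ p) (f : Ctb τ T) :
    BddAbove (range fun t => p (f.1 t)) := by
  obtain ⟨C, hC, h⟩ := p.bound_of_continuous_normedSpace (continuous_le_dom (norm_le_mixed τ) hp)
  obtain ⟨-, D, hD⟩ := f.2
  refine ⟨C * D, ?_⟩
  rintro _ ⟨t, rfl⟩
  exact (h _).trans (mul_le_mul_of_nonneg_left (hD t) hC.le)

/-- The seminorm `f ↦ sup_{t ∈ [0,T]} p(f(t))` on `C_{τ,b}([0,T];U)`, for a `γ`-continuous seminorm
`p` on `U`. -/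
def supSeminorm (τ : SaksTopology 𝕜 U) (T : ℝ)
    (p : {p : Seminorm 𝕜 U // @Continuous U ℝ τ.mixed _ p}) : Seminorm 𝕜 (Ctb τ T) :=
  Seminorm.of (fun f => ⨆ t, p.1 (f.1 t))
    (fun f g => by
      refine Real.iSup_le (fun t => ?_) (add_nonneg (Real.iSup_nonneg fun _ => apply_nonneg _ _)
        (Real.iSup_nonneg fun _ => apply_nonneg _ _))
      exact (map_add_le_add p.1 _ _).trans (add_le_add
        (le_ciSup (bddAbove_seminorm τ p.1 p.2 f) t) (le_ciSup (bddAbove_seminorm τ p.1 p.2 g) t)))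
    (fun c f => by
      rw [Real.mul_iSup_of_nonneg (norm_nonneg c)]
      exact iSup_congr fun t => map_smul_eq_mul p.1 c _)

instance (τ : SaksTopology 𝕜 U) :
    Nonempty {p : Seminorm 𝕜 U // @Continuous U ℝ τ.mixed _ p} :=
  ⟨⟨0, @continuous_const U ℝ τ.mixed _ 0⟩⟩

/-- The locally convex topology `γ_∞` on `C_{τ,b}([0,T];U)`, induced by the seminorms
`f ↦ sup_{t ∈ [0,T]} p(f(t))` where `p` runs through the `γ`-continuous seminorms on `U`. -/
abbrev gammaInf (τ : SaksTopology 𝕜 U) (T : ℝ) : TopologicalSpace (Ctb τ T) :=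
  SeminormFamily.moduleFilterBasis (𝕜 := 𝕜) (supSeminorm τ T) |>.topology

end ControlSpace

section InputMap

variable {𝕜 : Type*} [RCLike 𝕜] {X : Type*} [NormedAddCommGroup X] [NormedSpace 𝕜 X]
  [NormedSpace ℝ X] {U : Type*} [NormedAddCommGroup U] [NormedSpace 𝕜 U] [NormedSpace ℝ U]

/-- The integrand `t ↦ S_{T-t} B u(t)` on `[0,T]`. -/
def inputIntegrand (S : ℝ → X →L[𝕜] X) (B : U →L[𝕜] X) {T : ℝ} (u : Icc (0 : ℝ) T → U)
    (t : Icc (0 : ℝ) T) : X :=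
  S (T - t) (B (u t))

/-- Lebesgue measure on `[0,T]`. -/
def lebesgueIcc (T : ℝ) : Measure (Icc (0 : ℝ) T) :=
  (volume : Measure ℝ).comap Subtype.val

/-- The input map `𝓑^T u = ∫_0^T S_{T-t} B u(t) dt`, as a Pettis integral in `(X, γ_X)`. -/
def inputMap (τX : SaksTopology 𝕜 X) (τU : SaksTopology 𝕜 U) (S : ℝ → X →L[𝕜] X) (B : U →L[𝕜] X)
    (T : ℝ) (u : Ctb τU T) : X :=
  pettisIntegral 𝕜 τX.mixed (lebesgueIcc T) (inputIntegrand S B u.1)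

/-- The functional `(𝓑^T)° x°` on `C_{τ,b}([0,T];U)`, `⟨(𝓑^T)° x°, u⟩ = ⟨x°, 𝓑^T u⟩`. -/
def dualInputMap (τX : SaksTopology 𝕜 X) (τU : SaksTopology 𝕜 U) (S : ℝ → X →L[𝕜] X)
    (B : U →L[𝕜] X) (T : ℝ) (x' : StrongDual 𝕜 X) (u : Ctb τU T) : 𝕜 :=
  x' (inputMap τX τU S B T u)

end InputMap

section VectorMeasures

/-- The `σ`-algebra of `Ω`, as a type. -/
abbrev MeasSet (Ω : Type*) [MeasurableSpace Ω] : Type _ := {N : Set Ω // MeasurableSet N}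

variable {𝕜 : Type*} [RCLike 𝕜] {U : Type*} {Ω : Type*} [MeasurableSpace Ω]

/-- `N 0, …, N (n-1)` is a finite partition of `Ω` into disjoint measurable sets. -/
def IsPartition {n : ℕ} (N : Fin n → MeasSet Ω) : Prop :=
  (Pairwise fun i j => Disjoint (N i).1 (N j).1) ∧ ⋃ i, (N i).1 = univ

/-- The space `M(Ω;(U,ϑ)')` of vector measures. In the last clause, `p` runs through the
`ϑ`-continuous seminorms, so that it does not depend on a choice of seminorms defining `ϑ`. -/
structure IsDualVectorMeasure [AddCommGroup U] [Module 𝕜 U] (ϑ : TopologicalSpace U)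
    (ν : MeasSet Ω → U → 𝕜) : Prop where
  isLinearMap : ∀ N, IsLinearMap 𝕜 (ν N)
  continuous : ∀ N, @Continuous U 𝕜 ϑ _ (ν N)
  additive : ∀ N₁ N₂ : MeasSet Ω, Disjoint N₁.1 N₂.1 →
    ν ⟨N₁.1 ∪ N₂.1, N₁.2.union N₂.2⟩ = ν N₁ + ν N₂
  scalar_measure : ∀ u : U, ∃ μ : VectorMeasure Ω 𝕜, ∀ N : MeasSet Ω, μ N.1 = ν N u
  bounded_semivariation : ∃ p : Seminorm 𝕜 U, @Continuous U ℝ ϑ _ p ∧ ∃ C : ℝ,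
    ∀ (n : ℕ) (N : Fin n → MeasSet Ω) (u : Fin n → U), IsPartition N → (∀ i, p (u i) ≤ 1) →
      ‖∑ i, ν (N i) (u i)‖ ≤ C

/-- The semivariation norm `‖ν‖_var`. -/
def semivariation [NormedAddCommGroup U] (ν : MeasSet Ω → U → 𝕜) : ℝ≥0∞ :=
  ⨆ (n : ℕ) (N : Fin n → MeasSet Ω) (u : Fin n → U) (_ : IsPartition N) (_ : ∀ i, ‖u i‖ ≤ 1),
    ‖∑ i, ν (N i) (u i)‖ₑ

/-- `∫ u dν` exists and equals `L`: the sums `∑ i, ν(N i)(u(t i))`, over finite measurable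
partitions with tags `t i ∈ N i`, converge to `L` along refinement of partitions. -/
def HasVectorIntegral (ν : MeasSet Ω → U → 𝕜) (u : Ω → U) (L : 𝕜) : Prop :=
  ∀ ε > 0, ∃ (m : ℕ) (N₀ : Fin m → MeasSet Ω), IsPartition N₀ ∧
    ∀ (n : ℕ) (N : Fin n → MeasSet Ω) (t : Fin n → Ω), IsPartition N →
      (∀ i, ∃ j, (N i).1 ⊆ (N₀ j).1) → (∀ i, t i ∈ (N i).1) →
        ‖∑ i, ν (N i) (u (t i)) - L‖ < ε

/-- The measure `φ ⊙ μ`, `(φ ⊙ μ)(N)u = ∫_N ⟨φ(t), u⟩ dμ(t)`. -/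
def odot [NormedAddCommGroup U] [NormedSpace 𝕜 U] (φ : Ω → StrongDual 𝕜 U) (μ : Measure Ω)
    (N : MeasSet Ω) (u : U) : 𝕜 :=
  ∫ t in N.1, φ t u ∂μ

end VectorMeasures

end BiCont

end

/-! Everything follows from one domination estimate. For `x' ∈ X°` the supremum of `|x'(S_t x)|`
over `t ∈ [0,T]` is a seminorm `p`. By local bi-equicontinuity and the sequential continuity of
`x'`, it tends to zero along bounded `τ_X`-null sequences. Since `γ_X`-convergent sequences are
norm-bounded, C-sequentiality makes `p` `γ_X`-continuous
(`SaksTopology.CSequential.exists_seminorm_orbit`). A norm-bounded seminorm is `γ`-continuous once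
it is `τ`-continuous at zero on balls, so `q = p ∘ B` is `γ_U`-continuous and dominates every
`B°S_t°x°`.

This bound gives membership in `M([0,T];U_γ')` and `γ_∞`-continuity, both with constant `λ([0,T])`.
It also gives convergence of the Riemann sums, because `u` is uniformly `γ_U`-continuous on the
compact interval. The Pettis integral is a limit of integrals of simple functions: these are
norm-bounded and `τ_X`-Cauchy, hence `γ_X`-Cauchy, and sequential completeness applies.

For the norm identity, Riemann sums of a continuous function in the unit ball compete in the
semivariation. Conversely, a step function with values in the unit ball is approximated in `L¹` by
continuous functions, retracted radially into the ball (`norm_sum_odot_le`). Reflection of `[0,T]`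
removes the time reversal. -/

noncomputable section

namespace BiCont

/-! ### Uniform continuity, convex neighbourhoods and domination by seminorms -/

section TopologicalGroups

/-- On a compact space every neighbourhood of the diagonal is an entourage, so uniform continuity
needs no uniform structure on `E`. -/
theorem exists_dist_lt_sub_mem {Ω E : Type*} [PseudoMetricSpace Ω] [CompactSpace Ω] [AddGroup E]
    [TopologicalSpace E] [IsTopologicalAddGroup E] {f : Ω → E} (hf : Continuous f) {V : Set E}
    (hV : V ∈ 𝓝 (0 : E)) : ∃ δ > 0, ∀ s t, dist s t < δ → f s - f t ∈ V := by
  have hg : Continuous fun z : Ω × Ω => f z.1 - f z.2 :=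
    (hf.comp continuous_fst).sub (hf.comp continuous_snd)
  have h : {z : Ω × Ω | f z.1 - f z.2 ∈ V} ∈ 𝓝ˢ (diagonal Ω) := by
    refine mem_nhdsSet_iff_forall.2 fun z hz => hg.continuousAt ?_
    rw [mem_diagonal_iff] at hz
    simpa [hz] using hV
  rw [nhdsSet_diagonal_eq_uniformity] at h
  obtain ⟨δ, hδ, h⟩ := Metric.mem_uniformity_dist.1 h
  exact ⟨δ, hδ, fun s t hst => h hst⟩

theorem exists_closed_convex_nhds_zero {E : Type*} [AddCommGroup E] [Module ℝ E]
    [TopologicalSpace E] [IsTopologicalAddGroup E] [ContinuousSMul ℝ E] [LocallyConvexSpace ℝ E]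
    {V : Set E} (hV : V ∈ 𝓝 (0 : E)) :
    ∃ W ∈ 𝓝 (0 : E), IsClosed W ∧ Convex ℝ W ∧ W ⊆ V := by
  obtain ⟨C, hC, hCc, hCV⟩ := exists_mem_nhds_isClosed_subset hV
  obtain ⟨W, ⟨hW, hWc⟩, hWC⟩ := (LocallyConvexSpace.convex_basis_zero ℝ E).mem_iff.1 hC
  exact ⟨closure W, mem_of_superset hW subset_closure, isClosed_closure, hWc.closure,
    (closure_minimal hWC hCc).trans hCV⟩

theorem continuous_of_norm_le_seminorm {𝕜 E : Type*} [RCLike 𝕜] [AddCommGroup E] [Module 𝕜 E]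
    [TopologicalSpace E] [IsTopologicalAddGroup E] {p : Seminorm 𝕜 E} (hp : Continuous p)
    {f : E → 𝕜} (hf : IsLinearMap 𝕜 f) {C : ℝ} (h : ∀ x, ‖f x‖ ≤ C * p x) : Continuous f := by
  refine continuous_of_continuousAt_zero (hf.mk' f : E →ₗ[𝕜] 𝕜) ?_
  have h0 : Tendsto (fun x => C * p x) (𝓝 0) (𝓝 0) := by
    simpa using (hp.tendsto 0).const_mul C
  have : Tendsto f (𝓝 0) (𝓝 0) := squeeze_zero_norm h h0
  rw [ContinuousAt, map_zero]
  exact this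

theorem continuous_iff_seminorm_sub_lt {𝕜 E ι α : Type*} [NormedField 𝕜] [AddCommGroup E]
    [Module 𝕜 E] {p : SeminormFamily 𝕜 E ι} {_ : TopologicalSpace E} {_ : TopologicalSpace α}
    (hp : WithSeminorms p) {f : α → E} :
    Continuous f ↔ ∀ x i, ∀ ε > 0, ∀ᶠ y in 𝓝 x, p i (f y - f x) < ε := by
  rw [continuous_iff_continuousAt]
  exact forall_congr' fun x => hp.tendsto_nhds f (f x)

end TopologicalGroups

/-! ### The mixed topology -/

section Mixed

theorem CoincideOnBounded.nhdsWithin_eq {X : Type*} [NormedAddCommGroup X]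
    {t₁ t₂ : TopologicalSpace X} (h : CoincideOnBounded t₁ t₂)
    {s : Set X} (hs : Bornology.IsBounded s) {y : X} (hy : y ∈ s) :
    @nhdsWithin X t₁ y s = @nhdsWithin X t₂ y s := by
  rw [@nhdsWithin_eq_map_subtype_coe X t₁ s y hy, @nhdsWithin_eq_map_subtype_coe X t₂ s y hy]
  change map _ (@nhds s (t₁.induced _) _) = map _ (@nhds s (t₂.induced _) _)
  rw [h s hs]

variable {𝕜 : Type*} [RCLike 𝕜] {X : Type*} [NormedAddCommGroup X] [NormedSpace 𝕜 X]
  [NormedSpace ℝ X]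

theorem SaksTopology.mixed_isTopologicalAddGroup (τ : SaksTopology 𝕜 X) :
    @IsTopologicalAddGroup X τ.mixed _ := (mixed_mem_mixedCandidates τ).1

theorem SaksTopology.mixed_continuousSMul (τ : SaksTopology 𝕜 X) :
    @ContinuousSMul 𝕜 X _ _ τ.mixed := (mixed_mem_mixedCandidates τ).2.1

theorem SaksTopology.mixed_le_top (τ : SaksTopology 𝕜 X) : τ.mixed ≤ τ.top :=
  (mixed_mem_mixedCandidates τ).2.2.2.1

theorem SaksTopology.continuousSMul_real [IsScalarTower ℝ 𝕜 X] (τ : SaksTopology 𝕜 X) :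
    @ContinuousSMul ℝ X _ _ τ.top := by
  let _ := τ.top
  have := τ.continuousSMul
  exact IsScalarTower.continuousSMul 𝕜

/-- A single ball contains both the limit and eventually all values, and on it the two topologies
agree. -/
theorem SaksTopology.tendsto_mixed_of_tendsto_top (τ : SaksTopology 𝕜 X) {α : Type*} {l : Filter α}
    {f : α → X} {y : X} {C : ℝ} (hC : ∀ᶠ a in l, ‖f a‖ ≤ C) (h : Tendsto f l (@nhds X τ.top y)) :
    Tendsto f l (@nhds X τ.mixed y) := by
  have hb : Bornology.IsBounded (Metric.closedBall (0 : X) (max C ‖y‖)) :=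
    Metric.isBounded_closedBall
  have hy : y ∈ Metric.closedBall (0 : X) (max C ‖y‖) := by simp
  have h1 : Tendsto f l (@nhdsWithin X τ.top y (Metric.closedBall (0 : X) (max C ‖y‖))) := by
    refine tendsto_inf.2 ⟨h, tendsto_principal.2 (hC.mono fun a ha => ?_)⟩
    simp [ha]
  rw [← (mixed_mem_mixedCandidates τ).2.2.2.2.nhdsWithin_eq hb hy] at h1
  exact h1.mono_right inf_le_left

/-- A seminorm that is bounded for the norm and `τ`-continuous on bounded sets is continuous for the
mixed topology. -/
theorem SaksTopology.continuous_mixed_of_continuousOn_bounded (τ : SaksTopology 𝕜 X)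
    (p : Seminorm 𝕜 X) {C : ℝ} (hC : ∀ x, p x ≤ C * ‖x‖)
    (hp : ∀ r : ℝ, Tendsto p (@nhdsWithin X τ.top 0 (Metric.closedBall 0 r)) (𝓝 0)) :
    @Continuous X ℝ τ.mixed _ p := by
  let P : SeminormFamily 𝕜 X Unit := fun _ => p
  have hP := @WithSeminorms.mk 𝕜 X Unit _ _ _ P P.moduleFilterBasis.topology rfl
  -- Adjoining `p` to `τ` gives another candidate topology; the mixed topology is finer than it, so
  -- `p` becomes continuous.
  have hcand : τ.top ⊓ P.moduleFilterBasis.topology ∈ mixedCandidates τ := by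
    refine ⟨topologicalAddGroup_inf τ.isTopologicalAddGroup
      (@WithSeminorms.topologicalAddGroup _ _ _ _ _ _ P.moduleFilterBasis.topology _ hP), ?_, le_inf τ.norm_le ?_,
      inf_le_left, fun s hs => le_antisymm (induced_mono inf_le_left) ?_⟩
    · exact @continuousSMul_inf _ _ _ _ _ _ τ.continuousSMul
        (@WithSeminorms.continuousSMul _ _ _ _ _ _ P.moduleFilterBasis.topology _ hP)
    · refine continuous_id_iff_le.1 ((continuous_iff_seminorm_sub_lt hP).2 fun x _ ε hε => ?_)
      have : Tendsto (fun y => C * ‖y - x‖) (𝓝 x) (𝓝 0) := by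
        have h : Continuous fun y => C * ‖y - x‖ := by fun_prop
        simpa using h.tendsto x
      filter_upwards [this.eventually_lt_const hε] with y hy
      exact (hC _).trans_lt hy
    -- Differences of points of `s` stay in a ball of radius `r + r`, so the hypothesis at zero
    -- controls `p` near every point of `s`.
    · rw [induced_inf]
      refine le_inf le_rfl (continuous_iff_le_induced.1
        ((continuous_iff_seminorm_sub_lt hP (f := (Subtype.val : s → X))).2 fun x _ ε hε => ?_))
      let _ := τ.top
      have := τ.isTopologicalAddGroup
      obtain ⟨r, hr⟩ := hs.exists_norm_le
      have h1 : Tendsto (fun y : s => (y : X) - x) (@nhds s (τ.top.induced Subtype.val) x)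
          (@nhdsWithin X τ.top 0 (Metric.closedBall 0 (r + r))) := by
        refine tendsto_inf.2 ⟨?_, tendsto_principal.2 (Eventually.of_forall fun y => ?_)⟩
        · have h : Continuous fun y : s => (y : X) - x := continuous_subtype_val.sub continuous_const
          simpa using h.tendsto x
        · rw [mem_closedBall_zero_iff]
          exact (norm_sub_le _ _).trans (add_le_add (hr _ y.2) (hr _ x.2))
      exact ((hp _).comp h1).eventually_lt_const hε
  have hpc : @Continuous X ℝ P.moduleFilterBasis.topology _ p :=
    @WithSeminorms.continuous_seminorm _ _ _ _ _ _ P.moduleFilterBasis.topology _ hP ()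
  exact continuous_le_dom (sInf_le hcand) (continuous_le_dom inf_le_right hpc)

end Mixed

/-! ### Weighted suprema of functionals -/

section WeightedSup

variable {𝕜 : Type*} [RCLike 𝕜] {X : Type*} [NormedAddCommGroup X] [NormedSpace 𝕜 X]

/-- The seminorm `x ↦ sup_n |φ_n(x)| / (n + 1)` for contractive functionals `φ_n`. -/
def weightedSupSeminorm (φ : ℕ → X →ₗ[𝕜] 𝕜) (hφ : ∀ n y, ‖φ n y‖ ≤ ‖y‖) : Seminorm 𝕜 X :=
  have hb : ∀ x, BddAbove (range fun n : ℕ => ‖φ n x‖ / (n + 1)) := fun x => by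
    refine ⟨‖x‖, ?_⟩
    rintro _ ⟨n, rfl⟩
    exact (div_le_self (norm_nonneg _) (by linarith [n.cast_nonneg (α := ℝ)])).trans (hφ n x)
  Seminorm.of (fun x => ⨆ n : ℕ, ‖φ n x‖ / (n + 1))
    (fun x y => by
      refine ciSup_le fun n => ?_
      rw [map_add]
      refine (div_le_div_of_nonneg_right (norm_add_le _ _) (by positivity)).trans ?_
      rw [add_div]
      exact add_le_add (le_ciSup (hb x) n) (le_ciSup (hb y) n))
    (fun c x => by
      rw [Real.mul_iSup_of_nonneg (norm_nonneg c)]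
      exact iSup_congr fun n => by rw [map_smul, norm_smul, mul_div_assoc])

theorem div_le_weightedSupSeminorm (φ : ℕ → X →ₗ[𝕜] 𝕜) (hφ : ∀ n y, ‖φ n y‖ ≤ ‖y‖) (n : ℕ)
    (x : X) : ‖φ n x‖ / (n + 1) ≤ weightedSupSeminorm φ hφ x := by
  refine le_ciSup (f := fun n : ℕ => ‖φ n x‖ / (n + 1)) ⟨‖x‖, ?_⟩ n
  rintro _ ⟨n, rfl⟩
  exact (div_le_self (norm_nonneg _) (by linarith [n.cast_nonneg (α := ℝ)])).trans (hφ n x)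

end WeightedSup

/-! ### Convergent sequences and C-sequentiality -/

section Sequences

variable {𝕜 : Type*} [RCLike 𝕜] {X : Type*} [NormedAddCommGroup X] [NormedSpace 𝕜 X]
  [NormedSpace ℝ X]

theorem SaksTopology.exists_norm_sub_one_le (τ : SaksTopology 𝕜 X) (x : X) :
    ∃ x' : X →ₗ[𝕜] 𝕜, @Continuous X 𝕜 τ.top _ x' ∧ (∀ y, ‖x' y‖ ≤ ‖y‖) ∧ ‖x‖ - 1 ≤ ‖x' x‖ := by
  obtain ⟨_, ⟨x', h1, h2, rfl⟩, h3, -⟩ := (τ.norming x).exists_between (sub_one_lt ‖x‖)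
  exact ⟨x', h1, h2, h3.le⟩

/-- On a ball of radius `r` the weights make all terms of large index uniformly small, and the
finitely many others are `τ`-continuous. -/
theorem SaksTopology.continuous_mixed_weightedSupSeminorm (τ : SaksTopology 𝕜 X)
    (φ : ℕ → X →ₗ[𝕜] 𝕜) (hφ : ∀ n y, ‖φ n y‖ ≤ ‖y‖) (hc : ∀ n, @Continuous X 𝕜 τ.top _ (φ n)) :
    @Continuous X ℝ τ.mixed _ (weightedSupSeminorm φ hφ) := by
  refine τ.continuous_mixed_of_continuousOn_bounded _ (C := 1) (fun x => ?_) fun r => ?_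
  · rw [one_mul]
    exact ciSup_le fun n =>
      (div_le_self (norm_nonneg _) (by linarith [n.cast_nonneg (α := ℝ)])).trans (hφ n x)
  · let _ := τ.top
    refine tendsto_order.2 ⟨fun a ha => Eventually.of_forall fun x =>
      ha.trans_le (apply_nonneg _ _), fun ε hε => ?_⟩
    obtain ⟨k, hk⟩ := exists_nat_gt (r / (ε / 2))
    have h1 : ∀ᶠ x in @nhdsWithin X τ.top 0 (Metric.closedBall 0 r),
        ∀ n ∈ Finset.range k, ‖φ n x‖ < ε / 2 := by
      refine (Filter.eventually_all_finset _).2 fun n _ => ?_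
      have h := ((hc n).norm.tendsto 0).mono_left (inf_le_left : @nhdsWithin X τ.top 0
        (Metric.closedBall 0 r) ≤ _)
      rw [map_zero, norm_zero] at h
      exact h.eventually_lt_const (half_pos hε)
    filter_upwards [h1, (inf_le_right : @nhdsWithin X τ.top 0 (Metric.closedBall 0 r) ≤ _)
      (mem_principal_self _)] with x hx hxr
    rw [mem_closedBall_zero_iff] at hxr
    refine lt_of_le_of_lt (ciSup_le fun n => ?_) (half_lt_self hε)
    rcases lt_or_ge n k with hn | hn
    · exact (div_le_self (norm_nonneg _) (by linarith [n.cast_nonneg (α := ℝ)])).trans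
        (hx n (Finset.mem_range.2 hn)).le
    · have hkn : (k : ℝ) ≤ n := by exact_mod_cast hn
      rw [div_lt_iff₀ (half_pos hε)] at hk
      rw [div_le_iff₀ (by positivity)]
      nlinarith [hφ n x]

/-- Sequences that converge in the mixed topology are norm-bounded. -/
theorem SaksTopology.isBounded_range_of_tendsto_mixed (τ : SaksTopology 𝕜 X) {x : ℕ → X} {y : X}
    (h : Tendsto x atTop (@nhds X τ.mixed y)) : Bornology.IsBounded (range x) := by
  by_contra hb
  -- The norming functional loses `1` and the weight divides by `k + 1`, so this growth forces `p (x
  -- (n k)) > k + 1`, although the `γ`-continuous `p` is bounded along `x`.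
  have hlarge : ∀ k : ℕ, ∃ n, ((k : ℝ) + 1) * (k + 1) + 1 < ‖x n‖ := fun k => by
    by_contra! hk
    refine hb (isBounded_iff_forall_norm_le.2 ⟨((k : ℝ) + 1) * (k + 1) + 1, ?_⟩)
    rintro _ ⟨n, rfl⟩
    exact hk n
  choose n hn using hlarge
  choose φ hφc hφ hφn using fun k => τ.exists_norm_sub_one_le (x (n k))
  set p := weightedSupSeminorm φ hφ
  have hp := τ.continuous_mixed_weightedSupSeminorm φ hφ hφc
  have hlim : Tendsto (fun m => p (x m)) atTop (𝓝 (p y)) :=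
    (@Continuous.tendsto X ℝ τ.mixed _ _ hp y).comp h
  obtain ⟨C, hC⟩ := hlim.bddAbove_range
  obtain ⟨k, hk⟩ := exists_nat_gt C
  have h1 : p (x (n k)) ≤ C := hC ⟨n k, rfl⟩
  have h2 := div_le_weightedSupSeminorm φ hφ k (x (n k))
  rw [div_le_iff₀ (by positivity)] at h2
  have h3 := hφn k
  have h4 := hn k
  have h5 : p (x (n k)) * (k + 1) ≤ C * (k + 1) := by gcongr
  change _ ≤ p (x (n k)) * (k + 1) at h2
  nlinarith [k.cast_nonneg (α := ℝ)]

/-- In a C-sequential Saks space, sequentially continuous seminorms are continuous. -/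
theorem SaksTopology.CSequential.continuous_seminorm [IsScalarTower ℝ 𝕜 X] {τ : SaksTopology 𝕜 X}
    (hτ : τ.CSequential) (p : Seminorm 𝕜 X)
    (hp : ∀ x : ℕ → X, Bornology.IsBounded (range x) → Tendsto x atTop (@nhds X τ.top 0) →
      Tendsto (fun n => p (x n)) atTop (𝓝 0)) : @Continuous X ℝ τ.mixed _ p := by
  have hg := τ.mixed_isTopologicalAddGroup
  have hm := τ.mixed_continuousSMul
  -- The unit ball of `p` is convex, so only sequential openness remains; subadditivity reduces it
  -- to null sequences.
  have hopen : @IsOpen X τ.mixed (p.ball 0 1) := by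
    refine hτ _ (p.convex_ball 0 1) fun x y hy hxy => ?_
    have h1 : Tendsto (fun n => x n - y) atTop (@nhds X τ.mixed 0) := by
      let _ := τ.mixed
      simpa using Filter.Tendsto.sub hxy (tendsto_const_nhds (x := y))
    have h2 := hp _ (τ.isBounded_range_of_tendsto_mixed h1)
      (h1.mono_right (nhds_mono τ.mixed_le_top))
    rw [p.mem_ball_zero] at hy
    filter_upwards [h2.eventually_lt_const (sub_pos.2 hy)] with n hn
    rw [p.mem_ball_zero]
    have := map_add_le_add p (x n - y) y
    rw [sub_add_cancel] at this
    linarith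
  let _ := τ.mixed
  exact Seminorm.continuous (r := 1) (hopen.mem_nhds (by simp [p.mem_ball_zero]))

end Sequences

/-! ### Uniform domination of orbit functionals -/

section Orbits

variable {𝕜 : Type*} [RCLike 𝕜] {X : Type*} [NormedAddCommGroup X] [NormedSpace 𝕜 X]
  [NormedSpace ℝ X] {τ : SaksTopology 𝕜 X} {S : ℝ → X →L[𝕜] X}

theorem IsLocallyBiContinuous.exists_norm_le (hS : IsLocallyBiContinuous τ S) (T : ℝ) :
    ∃ K, 0 ≤ K ∧ ∀ t ∈ Icc 0 T, ‖S t‖ ≤ K := by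
  obtain ⟨M, ω, hM, h⟩ := hS.exp_bounded
  refine ⟨M * Real.exp (|ω| * T), by positivity, fun t ht => (h t ht.1).trans ?_⟩
  gcongr
  · exact ht.1
  · exact le_abs_self ω
  · exact ht.2

/-- Uniformity in time lets `t` vary with `n`: `S (t n) (x n)` is again bounded and `τ`-null, hence
a test sequence for `x'`. -/
theorem tendsto_sunDual_orbit (hS : IsLocallyBiContinuous τ S) {x' : StrongDual 𝕜 X}
    (hx' : x' ∈ τ.sunDual) {T : ℝ} {x : ℕ → X} (hb : Bornology.IsBounded (range x))
    (hx : Tendsto x atTop (@nhds X τ.top 0)) {t : ℕ → ℝ} (ht : ∀ n, t n ∈ Icc 0 T) :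
    Tendsto (fun n => x' (S (t n) (x n))) atTop (𝓝 0) := by
  obtain ⟨K, hK0, hK⟩ := hS.exists_norm_le T
  obtain ⟨C, hC⟩ := hb.exists_norm_le
  rw [← map_zero x']
  refine hx' (fun n => S (t n) (x n)) 0 (isBounded_iff_forall_norm_le.2 ⟨K * C, ?_⟩) ?_
  · rintro _ ⟨n, rfl⟩
    exact ((S (t n)).le_of_opNorm_le (hK _ (ht n)) _).trans
      (mul_le_mul_of_nonneg_left (hC _ ⟨n, rfl⟩) hK0)
  · refine fun V hV => mem_map.2 ?_
    filter_upwards [hS.bi_equicontinuous x 0 hb hx T V hV] with n hn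
    simpa using hn (t n) (ht n)

/-- For `x' ∈ X°`, the orbit functionals `x' ∘ S_t`, `t ∈ [0,T]`, are dominated by one seminorm that
is continuous for the mixed topology. -/
theorem SaksTopology.CSequential.exists_seminorm_orbit [IsScalarTower ℝ 𝕜 X]
    (hτ : τ.CSequential) (hS : IsLocallyBiContinuous τ S) {x' : StrongDual 𝕜 X}
    (hx' : x' ∈ τ.sunDual) {T : ℝ} (hT : 0 ≤ T) :
    ∃ p : Seminorm 𝕜 X, @Continuous X ℝ τ.mixed _ p ∧
      ∀ t ∈ Icc 0 T, ∀ x, ‖x' (S t x)‖ ≤ p x := by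
  obtain ⟨K, hK0, hK⟩ := hS.exists_norm_le T
  let q : Icc 0 T → Seminorm 𝕜 X := fun t => (normSeminorm 𝕜 𝕜).comp (x'.comp (S t)).toLinearMap
  have hq : ∀ t x, q t x = ‖x' (S t x)‖ := fun t x => rfl
  have hqb : BddAbove (range q) := by
    rw [Seminorm.bddAbove_range_iff]
    refine fun x => ⟨‖x'‖ * (K * ‖x‖), ?_⟩
    rintro _ ⟨t, rfl⟩
    exact (x'.le_opNorm _).trans (mul_le_mul_of_nonneg_left
      ((S t).le_of_opNorm_le (hK t t.2) x) (norm_nonneg _))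
  have hqx : ∀ x, BddAbove (range fun t => q t x) := Seminorm.bddAbove_range_iff.1 hqb
  refine ⟨⨆ t, q t, hτ.continuous_seminorm _ fun x hb hx => ?_, fun t ht x => ?_⟩
  · have : Nonempty (Icc 0 T) := ⟨⟨0, le_rfl, hT⟩⟩
    -- Near-maximising times, with error `1/(n+1)`, replace the supremum by a single sequence of
    -- orbit values.
    have hex : ∀ n : ℕ, ∃ t : Icc 0 T, (⨆ t, q t) (x n) - 1 / ((n : ℝ) + 1) < ‖x' (S t (x n))‖ := by
      intro n
      rw [Seminorm.iSup_apply hqb]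
      exact exists_lt_of_lt_ciSup (sub_lt_self _ (by positivity))
    choose t ht using hex
    have h1 := (tendsto_sunDual_orbit hS hx' hb hx (fun n => (t n).2)).norm.add
      (tendsto_one_div_add_atTop_nhds_zero_nat (𝕜 := ℝ))
    rw [norm_zero, add_zero] at h1
    exact squeeze_zero (fun n => apply_nonneg _ _) (fun n => (sub_lt_iff_lt_add.1 (ht n)).le) h1
  · rw [Seminorm.iSup_apply hqb]
    exact le_ciSup (hqx x) ⟨t, ht⟩

end Orbits

/-! ### Existence of Pettis integrals -/

section PettisIntegral

/-- Composing any `f` with `π` gives a simple function, which is Bochner integrable even when `f` is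
only `τ`-continuous. -/
theorem exists_simpleFunc_dist_lt (Ω : Type*) [PseudoMetricSpace Ω] [CompactSpace Ω] [Nonempty Ω]
    [MeasurableSpace Ω] [OpensMeasurableSpace Ω] {δ : ℝ} (hδ : 0 < δ) :
    ∃ π : SimpleFunc Ω Ω, ∀ t, dist (π t) t < δ := by
  let e := TopologicalSpace.denseSeq Ω
  have hcover : (univ : Set Ω) ⊆ ⋃ n, Metric.ball (e n) δ := fun t _ => by
    obtain ⟨n, hn⟩ := (TopologicalSpace.denseRange_denseSeq Ω).exists_dist_lt t hδ
    exact mem_iUnion.2 ⟨n, hn⟩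
  obtain ⟨s, hs⟩ := isCompact_univ.elim_finite_subcover _ (fun _ => Metric.isOpen_ball) hcover
  obtain ⟨k, hk⟩ := s.exists_nat_subset_range
  refine ⟨SimpleFunc.nearestPt e k, fun t => ?_⟩
  obtain ⟨n, hn, htn⟩ := mem_iUnion₂.1 (hs (mem_univ t))
  have h := SimpleFunc.edist_nearestPt_le e t (Finset.mem_range.1 (hk hn)).le
  rw [edist_dist, edist_dist, ENNReal.ofReal_le_ofReal_iff dist_nonneg] at h
  rw [Metric.mem_ball, dist_comm] at htn
  exact h.trans_lt htn

variable {𝕜 : Type*} [RCLike 𝕜] {X : Type*} [NormedAddCommGroup X] [NormedSpace 𝕜 X]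
  [NormedSpace ℝ X] {τ : SaksTopology 𝕜 X}
  {Ω : Type*} [PseudoMetricSpace Ω]

theorem SaksTopology.continuous_mixed_of_continuous_top {f : Ω → X}
    (hf : @Continuous Ω X _ τ.top f) {C : ℝ} (hC : ∀ t, ‖f t‖ ≤ C) :
    @Continuous Ω X _ τ.mixed f := by
  refine (@continuous_iff_continuousAt _ _ _ τ.mixed _).2 fun t => ?_
  exact τ.tendsto_mixed_of_tendsto_top (Eventually.of_forall hC)
    ((@continuous_iff_continuousAt _ _ _ τ.top _).1 hf t)

variable [CompactSpace Ω]

/-- The difference is the total mass times an average of `f (π m t) - f (π n t)`. These values lie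
in a closed convex `τ`-neighbourhood of zero, which also contains their average. -/
theorem SaksTopology.tendsto_integral_sub_integral [MeasurableSpace Ω] [CompleteSpace X]
    [IsScalarTower ℝ 𝕜 X] (τ : SaksTopology 𝕜 X)
    (μ : Measure Ω) [IsFiniteMeasure μ] {f : Ω → X} (hf : @Continuous Ω X _ τ.top f)
    {π : ℕ → SimpleFunc Ω Ω} (hπ : ∀ n t, dist (π n t) t < 1 / ((n : ℝ) + 1)) :
    Tendsto (fun k : ℕ × ℕ => ∫ t, (π k.1).map f t ∂μ - ∫ t, (π k.2).map f t ∂μ) atTop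
      (@nhds X τ.top 0) := by
  rcases eq_or_ne μ 0 with rfl | hμ
  · simp only [integral_zero_measure, sub_zero]
    exact @tendsto_const_nhds _ τ.top _ _ _
  have : NeZero μ := ⟨hμ⟩
  have hg := τ.isTopologicalAddGroup
  have hm := τ.continuousSMul_real
  have hlc := τ.locallyConvex
  intro V hV
  have hV' : {x : X | μ.real univ • x ∈ V} ∈ @nhds X τ.top 0 := by
    let _ := τ.top
    exact (continuous_const_smul (μ.real univ)).continuousAt (by simpa using hV)
  obtain ⟨W, hW, hWcl, hWc, hWV⟩ := @exists_closed_convex_nhds_zero X _ _ τ.top hg hm hlc _ hV'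
  obtain ⟨δ, hδ, h⟩ := @exists_dist_lt_sub_mem Ω X _ _ _ τ.top hg f hf W hW
  obtain ⟨n₀, hn₀⟩ := exists_nat_one_div_lt (half_pos hδ)
  refine mem_map.2 (mem_of_superset (mem_atTop (n₀, n₀)) fun k hk => ?_)
  have hk' : ∀ n ≥ n₀, ∀ t, dist (π n t) t < δ / 2 := fun n hn t =>
    (hπ n t).trans ((one_div_le_one_div_of_le (by positivity) (by gcongr)).trans_lt hn₀)
  have hint : ∀ n, Integrable ((π n).map f) μ := fun n => SimpleFunc.integrable_of_isFiniteMeasure _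
  rw [mem_preimage, ← integral_sub (hint _) (hint _), ← measure_smul_average]
  -- The Bochner average lives in the norm topology, where the `τ`-closed set `W` is closed as well.
  refine hWV (hWc.average_mem (hWcl.mono τ.norm_le) (Eventually.of_forall fun t => ?_)
    ((hint _).sub (hint _)))
  refine h _ _ ((dist_triangle_right _ _ t).trans_lt ?_)
  linarith [hk' _ hk.1 t, hk' _ hk.2 t]

variable [MeasurableSpace Ω] [BorelSpace Ω]

theorem integrable_of_continuous_of_compactSpace {μ : Measure Ω} [IsFiniteMeasure μ] {g : Ω → 𝕜}
    (hg : Continuous g) : Integrable g μ := by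
  obtain ⟨C, hC⟩ := isCompact_univ.exists_bound_of_continuousOn hg.continuousOn
  exact .of_bound hg.aestronglyMeasurable C (Eventually.of_forall fun t => hC t (mem_univ t))

variable [Nonempty Ω] [CompleteSpace X]

/-- Norm bounds upgrade `τ`-Cauchy to `γ`-Cauchy; dominated convergence identifies the limit. The
measure is arbitrary so that restrictions `μ.restrict N` are covered too. -/
theorem SaksTopology.SeqComplete.exists_apply_eq_integral [IsScalarTower ℝ 𝕜 X]
    (hτ : τ.SeqComplete) (μ : Measure Ω) [IsFiniteMeasure μ] {f : Ω → X}
    (hf : @Continuous Ω X _ τ.top f) {C : ℝ} (hC : ∀ t, ‖f t‖ ≤ C) :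
    ∃ y : X, ∀ x' : X →ₗ[𝕜] 𝕜, @Continuous X 𝕜 τ.mixed _ x' → x' y = ∫ t, x' (f t) ∂μ := by
  choose π hπ using fun n : ℕ => exists_simpleFunc_dist_lt Ω (one_div_pos.2 n.cast_add_one_pos)
  have hint : ∀ n, Integrable ((π n).map f) μ := fun n => SimpleFunc.integrable_of_isFiniteMeasure _
  have hb : ∀ n, ‖∫ t, (π n).map f t ∂μ‖ ≤ C * μ.real univ := fun n =>
    norm_integral_le_of_norm_le_const (Eventually.of_forall fun t => hC _)
  obtain ⟨y, hy⟩ := hτ (fun n => ∫ t, (π n).map f t ∂μ) fun V hV => by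
    have h := τ.tendsto_mixed_of_tendsto_top (Eventually.of_forall fun k =>
      (norm_sub_le _ _).trans (add_le_add (hb _) (hb _))) (τ.tendsto_integral_sub_integral μ hf hπ)
    obtain ⟨n₀, hn₀⟩ := eventually_atTop.1 (h.eventually_mem hV)
    exact ⟨max n₀.1 n₀.2, fun m hm n hn =>
      hn₀ (m, n) ⟨(le_max_left _ _).trans hm, (le_max_right _ _).trans hn⟩⟩
  refine ⟨y, fun x' hx' => ?_⟩
  have hxf : Continuous fun t => x' (f t) :=
    @Continuous.comp _ _ _ _ τ.mixed _ _ _ hx' (SaksTopology.continuous_mixed_of_continuous_top hf hC)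
  have h1 : Tendsto (fun n => x' (∫ t, (π n).map f t ∂μ)) atTop (𝓝 (x' y)) :=
    (@Continuous.tendsto X 𝕜 τ.mixed _ _ hx' y).comp hy
  refine tendsto_nhds_unique h1 ?_
  let L : StrongDual 𝕜 X := ⟨x', continuous_le_dom (norm_le_mixed τ) hx'⟩
  have h2 : ∀ n, x' (∫ t, (π n).map f t ∂μ) = ∫ t, x' (f (π n t)) ∂μ := fun n =>
    (L.integral_comp_comm (hint n)).symm
  simp_rw [h2]
  refine tendsto_integral_of_dominated_convergence (fun _ => ‖L‖ * C)
    (fun n => (L.integrable_comp (hint n)).aestronglyMeasurable) (integrable_const _)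
    (fun n => Eventually.of_forall fun t => (L.le_opNorm _).trans
      (mul_le_mul_of_nonneg_left (hC _) (norm_nonneg _))) (Eventually.of_forall fun t => ?_)
  refine (hxf.tendsto t).comp (tendsto_iff_dist_tendsto_zero.2 ?_)
  exact squeeze_zero (fun _ => dist_nonneg) (fun n => (hπ n t).le)
    tendsto_one_div_add_atTop_nhds_zero_nat

/-- Bounded `τ`-continuous functions on a compact space are Pettis integrable for the mixed topology
of a sequentially complete Saks space. -/
theorem SaksTopology.SeqComplete.exists_hasPettisIntegral [IsScalarTower ℝ 𝕜 X]
    (hτ : τ.SeqComplete) (μ : Measure Ω) [IsFiniteMeasure μ] {f : Ω → X}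
    (hf : @Continuous Ω X _ τ.top f) {C : ℝ} (hC : ∀ t, ‖f t‖ ≤ C) :
    ∃ x, HasPettisIntegral 𝕜 τ.mixed μ f x := by
  obtain ⟨x, hx⟩ := hτ.exists_apply_eq_integral μ hf hC
  exact ⟨x, fun x' hx' => integrable_of_continuous_of_compactSpace
    (@Continuous.comp _ _ _ _ τ.mixed _ _ _ hx'
      (SaksTopology.continuous_mixed_of_continuous_top hf hC)),
    fun N _ => hτ.exists_apply_eq_integral (μ.restrict N) hf hC, hx⟩

end PettisIntegral

/-! ### Finite measurable partitions -/

section Partitions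

variable {Ω : Type*} [MeasurableSpace Ω]

/-- With the index function `k`, a sum over cells becomes one integral, and estimates become
pointwise. -/
theorem IsPartition.exists_index {n : ℕ} {N : Fin n → MeasSet Ω} (hN : IsPartition N) :
    ∃ k : SimpleFunc Ω (Fin n), ∀ t i, t ∈ (N i).1 ↔ k t = i := by
  have hex : ∀ t, ∃ i, t ∈ (N i).1 := fun t => mem_iUnion.1 (hN.2 ▸ mem_univ t)
  choose k hk using hex
  have hiff : ∀ t i, t ∈ (N i).1 ↔ k t = i := fun t i => by
    refine ⟨fun ht => ?_, fun h => h ▸ hk t⟩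
    by_contra h
    exact disjoint_left.1 (hN.1 h) (hk t) ht
  have hpre : ∀ i, k ⁻¹' {i} = (N i).1 := fun i => by
    ext t
    exact (hiff t i).symm
  exact ⟨⟨k, fun i => (hpre i).symm ▸ (N i).2, toFinite _⟩, hiff⟩

theorem IsPartition.integrable_and_integral_eq {E : Type*} [NormedAddCommGroup E] [NormedSpace ℝ E]
    {n : ℕ} {N : Fin n → MeasSet Ω} (hN : IsPartition N) {k : SimpleFunc Ω (Fin n)}
    (hk : ∀ t i, t ∈ (N i).1 ↔ k t = i) {μ : Measure Ω} {g : Fin n → Ω → E}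
    (hg : ∀ i, Integrable (g i) μ) :
    Integrable (fun t => g (k t) t) μ ∧ ∫ t, g (k t) t ∂μ = ∑ i, ∫ t in (N i).1, g i t ∂μ := by
  have heq : ∀ i, EqOn (g i) (fun t => g (k t) t) (N i).1 := fun i t ht => by
    simp only [(hk t i).1 ht]
  have hi : ∀ i, IntegrableOn (fun t => g (k t) t) (N i).1 μ := fun i =>
    (hg i).integrableOn.congr_fun (heq i) (N i).2
  constructor
  · rw [← integrableOn_univ, ← hN.2]
    exact integrableOn_finite_iUnion.2 hi
  · rw [← setIntegral_univ, ← hN.2, integral_iUnion_fintype (fun i => (N i).2) hN.1 hi]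
    exact Finset.sum_congr rfl fun i _ => setIntegral_congr_fun (N i).2 (heq i).symm

theorem exists_partition_dist_lt (Ω : Type*) [PseudoMetricSpace Ω] [CompactSpace Ω] [Nonempty Ω]
    [MeasurableSpace Ω] [OpensMeasurableSpace Ω] {δ : ℝ} (hδ : 0 < δ) :
    ∃ (m : ℕ) (N : Fin m → MeasSet Ω) (s : Fin m → Ω), IsPartition N ∧ (∀ j, s j ∈ (N j).1) ∧
      ∀ j, ∀ t ∈ (N j).1, ∀ t' ∈ (N j).1, dist t t' < δ := by
  obtain ⟨π, hπ⟩ := exists_simpleFunc_dist_lt Ω (half_pos hδ)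
  -- Cells are the fibres over the range of `π`, so each is nonempty and admits a tag.
  let e := π.range.equivFin.symm
  have hs : ∀ j, ∃ t, π t = e j := fun j => SimpleFunc.mem_range.1 (e j).2
  choose s hs using hs
  refine ⟨_, fun j => ⟨π ⁻¹' {(e j).1}, π.measurableSet_preimage _⟩, s, ⟨fun i j hij => ?_, ?_⟩, hs,
    fun j t ht t' ht' => ?_⟩
  · refine disjoint_left.2 fun t hi hj => hij (e.injective (Subtype.ext ?_))
    exact hi.symm.trans hj
  · refine eq_univ_of_forall fun t => mem_iUnion.2 ⟨e.symm ⟨π t, SimpleFunc.mem_range_self _ _⟩, ?_⟩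
    simp
  · have h : π t = π t' := ht.trans ht'.symm
    have h1 := dist_triangle_left t t' (π t)
    have h2 := hπ t
    have h3 := hπ t'
    rw [← h] at h3
    linarith

end Partitions

/-! ### Measures with a dominated density -/

section Odot

variable {𝕜 : Type*} [RCLike 𝕜] {U : Type*} [NormedAddCommGroup U] [NormedSpace 𝕜 U]
  {Ω : Type*} [MeasurableSpace Ω] {μ : Measure Ω} {φ : Ω → StrongDual 𝕜 U} {p : Seminorm 𝕜 U}

/-- The common source of three estimates: `g = 0` bounds the semivariation, `g t = φ t (u t)`
controls Riemann sums, and a continuous `f` in place of `u` gives the norm identity. -/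
theorem IsPartition.norm_sum_odot_sub_integral_le {n : ℕ} {N : Fin n → MeasSet Ω}
    (hN : IsPartition N) {k : SimpleFunc Ω (Fin n)} (hk : ∀ t i, t ∈ (N i).1 ↔ k t = i)
    (hφ : ∀ u, Integrable (fun t => φ t u) μ) (u : Fin n → U) {g : Ω → 𝕜} (hg : Integrable g μ)
    {b : Ω → ℝ} (hb : Integrable b μ) (h : ∀ t, ‖φ t (u (k t)) - g t‖ ≤ b t) :
    ‖∑ i, odot φ μ (N i) (u i) - ∫ t, g t ∂μ‖ ≤ ∫ t, b t ∂μ := by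
  obtain ⟨h1, h2⟩ := hN.integrable_and_integral_eq hk (fun i => hφ (u i))
  simp only [odot]
  rw [← h2, ← integral_sub h1 hg]
  exact norm_integral_le_of_norm_le hb (Eventually.of_forall h)

variable [IsFiniteMeasure μ]

theorem isDualVectorMeasure_odot {ϑ : TopologicalSpace U} (hϑ : @IsTopologicalAddGroup U ϑ _)
    (hp : @Continuous U ℝ ϑ _ p) (hφ : ∀ u, Integrable (fun t => φ t u) μ)
    (hφp : ∀ t u, ‖φ t u‖ ≤ p u) : IsDualVectorMeasure ϑ (odot φ μ) := by
  have hlin : ∀ N, IsLinearMap 𝕜 (odot φ μ N) := fun N =>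
    ⟨fun u v => by simp only [odot, map_add]; exact integral_add (hφ u).integrableOn (hφ v).integrableOn,
      fun c u => by simp only [odot, map_smul]; exact integral_smul _ _⟩
  have hadd : ∀ N₁ N₂ : MeasSet Ω, Disjoint N₁.1 N₂.1 →
      odot φ μ ⟨N₁.1 ∪ N₂.1, N₁.2.union N₂.2⟩ = odot φ μ N₁ + odot φ μ N₂ := fun N₁ N₂ h => by
    ext u
    exact setIntegral_union h N₂.2 (hφ u).integrableOn (hφ u).integrableOn
  refine ⟨hlin, fun N => ?_, hadd, fun u => ⟨μ.withDensityᵥ fun t => φ t u, fun N =>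
    withDensityᵥ_apply (hφ u) N.2⟩, p, hp, μ.real univ, fun n N u hN hu => ?_⟩
  · exact @continuous_of_norm_le_seminorm 𝕜 U _ _ _ ϑ hϑ p hp _ (hlin N) (μ.real N.1) fun u =>
      (norm_setIntegral_le_of_norm_le_const (measure_lt_top _ _) fun t _ => hφp t u).trans_eq
        (mul_comm _ _)
  · obtain ⟨k, hk⟩ := hN.exists_index
    have h := hN.norm_sum_odot_sub_integral_le hk hφ u (integrable_zero Ω 𝕜 μ)
      (integrable_const (1 : ℝ)) fun t => by simpa using (hφp t _).trans (hu _)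
    simpa using h

variable [PseudoMetricSpace Ω] [CompactSpace Ω] [Nonempty Ω] [BorelSpace Ω]

/-- On cells of small diameter, uniform continuity makes `p` of the oscillation of `u` less than
`r`. The tags `s` allow `N₀` itself to be used as a refinement. -/
theorem exists_partition_norm_sum_odot_sub_lt {ϑ : TopologicalSpace U}
    (hϑ : @IsTopologicalAddGroup U ϑ _) (hp : @Continuous U ℝ ϑ _ p)
    (hφ : ∀ u, Integrable (fun t => φ t u) μ) (hφp : ∀ t u, ‖φ t u‖ ≤ p u) {u : Ω → U}
    (hu : @Continuous Ω U _ ϑ u) (hφu : Integrable (fun t => φ t (u t)) μ) {ε : ℝ} (hε : 0 < ε) :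
    ∃ (m : ℕ) (N₀ : Fin m → MeasSet Ω) (s : Fin m → Ω), IsPartition N₀ ∧ (∀ j, s j ∈ (N₀ j).1) ∧
      ∀ (n : ℕ) (N : Fin n → MeasSet Ω) (t : Fin n → Ω), IsPartition N →
        (∀ i, ∃ j, (N i).1 ⊆ (N₀ j).1) → (∀ i, t i ∈ (N i).1) →
          ‖∑ i, odot φ μ (N i) (u (t i)) - ∫ t, φ t (u t) ∂μ‖ < ε := by
  -- The `+ 1` keeps the inequality strict and covers measure zero.
  set r := ε / (μ.real univ + 1) with hr
  have hm : 0 < μ.real univ + 1 := by positivity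
  have hr0 : 0 < r := by positivity
  have hV : {v | p v < r} ∈ @nhds U ϑ 0 :=
    (@Continuous.tendsto U ℝ ϑ _ _ hp 0).eventually_lt_const (by simpa using hr0)
  obtain ⟨δ, hδ, h⟩ := @exists_dist_lt_sub_mem Ω U _ _ _ ϑ hϑ u hu _ hV
  obtain ⟨m, N₀, s, hN₀, hs, hd⟩ := exists_partition_dist_lt Ω hδ
  refine ⟨m, N₀, s, hN₀, hs, fun n N t hN hsub ht => ?_⟩
  obtain ⟨k, hk⟩ := hN.exists_index
  refine (hN.norm_sum_odot_sub_integral_le hk hφ (fun i => u (t i)) hφu (integrable_const r)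
    fun x => ?_).trans_lt ?_
  · obtain ⟨j, hj⟩ := hsub (k x)
    rw [← map_sub]
    exact (hφp _ _).trans (h _ _ (hd j _ (hj (ht _)) _ (hj ((hk x _).2 rfl)))).le
  · rw [integral_const, smul_eq_mul, hr, mul_div_assoc', div_lt_iff₀ hm]
    nlinarith

theorem hasVectorIntegral_odot {ϑ : TopologicalSpace U}
    (hϑ : @IsTopologicalAddGroup U ϑ _) (hp : @Continuous U ℝ ϑ _ p)
    (hφ : ∀ u, Integrable (fun t => φ t u) μ) (hφp : ∀ t u, ‖φ t u‖ ≤ p u) {u : Ω → U}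
    (hu : @Continuous Ω U _ ϑ u) (hφu : Integrable (fun t => φ t (u t)) μ) :
    HasVectorIntegral (odot φ μ) u (∫ t, φ t (u t) ∂μ) := fun _ hε => by
  obtain ⟨m, N₀, -, hN₀, -, h⟩ := exists_partition_norm_sum_odot_sub_lt hϑ hp hφ hφp hu hφu hε
  exact ⟨m, N₀, hN₀, h⟩

theorem enorm_integral_le_semivariation_odot {ϑ : TopologicalSpace U}
    (hϑ : @IsTopologicalAddGroup U ϑ _) (hp : @Continuous U ℝ ϑ _ p)
    (hφ : ∀ u, Integrable (fun t => φ t u) μ) (hφp : ∀ t u, ‖φ t u‖ ≤ p u) {u : Ω → U}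
    (hu : @Continuous Ω U _ ϑ u) (hφu : Integrable (fun t => φ t (u t)) μ)
    (hu1 : ∀ t, ‖u t‖ ≤ 1) : ‖∫ t, φ t (u t) ∂μ‖ₑ ≤ semivariation (odot φ μ) := by
  refine ENNReal.le_of_forall_pos_le_add fun ε hε _ => ?_
  obtain ⟨m, N, s, hN, hs, h⟩ := exists_partition_norm_sum_odot_sub_lt hϑ hp hφ hφp hu hφu
    (NNReal.coe_pos.2 hε)
  have h1 := h m N s hN (fun i => ⟨i, Subset.rfl⟩) hs
  have h2 : ‖∑ i, odot φ μ (N i) (u (s i))‖ₑ ≤ semivariation (odot φ μ) :=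
    le_iSup_of_le m <| le_iSup_of_le N <| le_iSup_of_le (fun i => u (s i)) <|
      le_iSup_of_le hN <| le_iSup_of_le (fun i => hu1 _) le_rfl
  calc ‖∫ t, φ t (u t) ∂μ‖ₑ
      = ‖∑ i, odot φ μ (N i) (u (s i)) -
          (∑ i, odot φ μ (N i) (u (s i)) - ∫ t, φ t (u t) ∂μ)‖ₑ := by rw [sub_sub_cancel]
    _ ≤ ‖∑ i, odot φ μ (N i) (u (s i))‖ₑ +
          ‖∑ i, odot φ μ (N i) (u (s i)) - ∫ t, φ t (u t) ∂μ‖ₑ := enorm_sub_le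
    _ ≤ semivariation (odot φ μ) + ε := by
      refine add_le_add h2 ?_
      rw [← ofReal_norm, ← ENNReal.ofReal_coe_nnreal]
      exact ENNReal.ofReal_le_ofReal h1.le

end Odot

/-! ### Radial retraction onto the unit ball -/

section Retraction

variable {U : Type*} [NormedAddCommGroup U] [NormedSpace ℝ U]

/-- The radial retraction onto the closed unit ball. -/
def radialRetraction (v : U) : U := (max 1 ‖v‖)⁻¹ • v

theorem continuous_radialRetraction : Continuous (radialRetraction : U → U) := by
  have h : ∀ v : U, max 1 ‖v‖ ≠ 0 := fun v => (lt_max_of_lt_left one_pos).ne'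
  exact ((continuous_const.max continuous_norm).inv₀ h).smul continuous_id

theorem norm_radialRetraction_le (v : U) : ‖radialRetraction v‖ ≤ 1 := by
  have h : 0 < max 1 ‖v‖ := lt_max_of_lt_left one_pos
  rw [radialRetraction, norm_smul, norm_inv, Real.norm_of_nonneg h.le, inv_mul_le_iff₀ h, mul_one]
  exact le_max_right _ _

/-- If `‖v‖ ≥ 1`, retracting moves `v` by `‖v‖ - 1 ≤ ‖v‖ - ‖w‖ ≤ ‖w - v‖`; the triangle inequality
gives the factor `2`. -/
theorem norm_sub_radialRetraction_le (v : U) {w : U} (hw : ‖w‖ ≤ 1) :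
    ‖w - radialRetraction v‖ ≤ 2 * ‖w - v‖ := by
  rcases le_total ‖v‖ 1 with hv | hv
  · rw [radialRetraction, max_eq_left hv, inv_one, one_smul]
    linarith [norm_nonneg (w - v)]
  · have hv0 : 0 < ‖v‖ := one_pos.trans_le hv
    have h : ‖v - radialRetraction v‖ = ‖v‖ - 1 := by
      have : v - radialRetraction v = (1 - ‖v‖⁻¹) • v := by
        rw [radialRetraction, max_eq_right hv, sub_smul, one_smul]
      rw [this, norm_smul, Real.norm_of_nonneg (sub_nonneg.2 (inv_le_one_of_one_le₀ hv)), sub_mul,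
        one_mul, inv_mul_cancel₀ hv0.ne']
    have h1 := norm_sub_norm_le v w
    rw [norm_sub_rev v w] at h1
    have h2 := norm_sub_le_norm_sub_add_norm_sub w v (radialRetraction v)
    linarith

end Retraction

/-! ### Semivariation as a dual norm -/

section NormEquality

variable {𝕜 : Type*} [RCLike 𝕜] {U : Type*} [NormedAddCommGroup U] [NormedSpace 𝕜 U]
  {Ω : Type*} [MeasurableSpace Ω] {μ : Measure Ω} {φ : Ω → StrongDual 𝕜 U}

theorem semivariation_odot_comp_le (σ : Ω ≃ᵐ Ω) (hσ : MeasurePreserving σ μ μ) :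
    semivariation (odot (fun t => φ (σ t)) μ) ≤ semivariation (odot φ μ) := by
  refine iSup_le fun n => iSup_le fun N => iSup_le fun u => iSup_le fun hN => iSup_le fun hu => ?_
  let N' : Fin n → MeasSet Ω := fun i => ⟨σ.symm ⁻¹' (N i).1, σ.symm.measurable (N i).2⟩
  have hN' : IsPartition N' := by
    refine ⟨fun i j hij => (hN.1 hij).preimage _, ?_⟩
    change ⋃ i, σ.symm ⁻¹' (N i).1 = univ
    rw [← preimage_iUnion, hN.2, preimage_univ]
  have heq : ∀ i, odot (fun t => φ (σ t)) μ (N i) (u i) = odot φ μ (N' i) (u i) := fun i => by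
    have h := hσ.setIntegral_preimage_emb σ.measurableEmbedding (fun t => φ t (u i)) (N' i).1
    have hpre : σ ⁻¹' (N' i).1 = (N i).1 := by
      ext t
      simp [N']
    rw [hpre] at h
    exact h
  rw [Finset.sum_congr rfl fun i _ => heq i]
  exact le_iSup_of_le n <| le_iSup_of_le N' <| le_iSup_of_le u <|
      le_iSup_of_le hN' <| le_iSup_of_le hu le_rfl

theorem semivariation_odot_comp (σ : Ω ≃ᵐ Ω) (hσ : MeasurePreserving σ μ μ) :
    semivariation (odot (fun t => φ (σ t)) μ) = semivariation (odot φ μ) := by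
  refine le_antisymm (semivariation_odot_comp_le σ hσ) ?_
  have h := semivariation_odot_comp_le (φ := fun t => φ (σ t)) σ.symm (hσ.symm σ)
  simpa using h

variable [NormedSpace ℝ U] [IsFiniteMeasure μ] [PseudoMetricSpace Ω] [CompactSpace Ω] [BorelSpace Ω]

/-- The step function `k.map u` is `L¹`-close to a continuous `g`. Retracting `g` keeps it a
competitor in `hK` and at most doubles the error, which the norm bound on `φ` passes to the sums. -/
theorem norm_sum_odot_le {C K : ℝ} (hC0 : 0 ≤ C) (hφ : ∀ u, Integrable (fun t => φ t u) μ)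
    (hC : ∀ t u, ‖φ t u‖ ≤ C * ‖u‖) (hφf : ∀ f : C(Ω, U), Integrable (fun t => φ t (f t)) μ)
    (hK : ∀ f : C(Ω, U), (∀ t, ‖f t‖ ≤ 1) → ‖∫ t, φ t (f t) ∂μ‖ ≤ K) {n : ℕ}
    {N : Fin n → MeasSet Ω} {u : Fin n → U} (hN : IsPartition N) (hu : ∀ i, ‖u i‖ ≤ 1) :
    ‖∑ i, odot φ μ (N i) (u i)‖ ≤ K := by
  obtain ⟨k, hk⟩ := hN.exists_index
  refine le_of_forall_pos_le_add fun ε hε => ?_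
  have hs : Integrable (k.map u) μ := SimpleFunc.integrable_of_isFiniteMeasure _
  set η := ε / (C * 2 + 1) with hη
  have hD : 0 < C * 2 + 1 := by positivity
  have hη0 : 0 < η := by positivity
  obtain ⟨g, hg, hgi⟩ := hs.exists_boundedContinuous_lintegral_sub_le
    (ENNReal.ofReal_pos.2 hη0).ne'
  let f : C(Ω, U) := ⟨fun t => radialRetraction (g t), continuous_radialRetraction.comp g.continuous⟩
  have hb : Integrable (fun t => C * (2 * ‖k.map u t - g t‖)) μ :=
    ((hs.sub hgi).norm.const_mul 2).const_mul C
  have h1 := hN.norm_sum_odot_sub_integral_le hk hφ u (hφf f) hb fun t => by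
    rw [← map_sub]
    exact (hC _ _).trans (mul_le_mul_of_nonneg_left (norm_sub_radialRetraction_le _ (hu _)) hC0)
  have h2 : ∫ t, ‖k.map u t - g t‖ ∂μ ≤ η := by
    have h := integral_norm_eq_lintegral_enorm (hs.sub hgi).aestronglyMeasurable
    simp only [Pi.sub_apply] at h
    rw [h]
    exact ENNReal.toReal_le_of_le_ofReal hη0.le hg
  rw [integral_const_mul, integral_const_mul] at h1
  have h3 := hK f fun t => norm_radialRetraction_le _
  have h4 : C * (2 * η) ≤ ε := by
    rw [hη, ← mul_assoc, mul_div_assoc', div_le_iff₀ hD]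
    nlinarith
  have h5 : C * (2 * ∫ t, ‖k.map u t - g t‖ ∂μ) ≤ C * (2 * η) := by gcongr
  have h6 := norm_le_norm_add_norm_sub' (∑ i, odot φ μ (N i) (u i)) (∫ t, φ t (f t) ∂μ)
  linarith

/-- The norm of the functional `f ↦ ∫ ⟨φ(t), f(t)⟩ dμ(t)` on the continuous functions is the
semivariation of `φ ⊙ μ`. -/
theorem enorm_eq_semivariation_odot [Nonempty Ω] {p : Seminorm 𝕜 U} (hp : Continuous p)
    (hφ : ∀ u, Integrable (fun t => φ t u) μ) (hφp : ∀ t u, ‖φ t u‖ ≤ p u)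
    (hφf : ∀ f : C(Ω, U), Integrable (fun t => φ t (f t)) μ) {Φ : StrongDual 𝕜 C(Ω, U)}
    (hΦ : ∀ f, Φ f = ∫ t, φ t (f t) ∂μ) : ‖Φ‖ₑ = semivariation (odot φ μ) := by
  obtain ⟨C, hC0, hC⟩ := p.bound_of_continuous_normedSpace hp
  apply le_antisymm
  · rw [← ofReal_norm]
    -- Finiteness is not assumed here; the infinite case is trivial and the finite one can be
    -- handled in `ℝ`.
    rcases eq_or_ne (semivariation (odot φ μ)) ⊤ with htop | htop
    · simp [htop]
    rw [ENNReal.ofReal_le_iff_le_toReal htop]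
    refine ContinuousLinearMap.opNorm_le_of_unit_norm ENNReal.toReal_nonneg fun f hf => ?_
    rw [← ENNReal.ofReal_le_iff_le_toReal htop, ofReal_norm, hΦ]
    exact enorm_integral_le_semivariation_odot inferInstance hp hφ hφp f.continuous (hφf f)
      fun t => (f.norm_coe_le_norm t).trans hf.le
  · refine iSup_le fun n => iSup_le fun N => iSup_le fun u => iSup_le fun hN => iSup_le fun hu => ?_
    rw [← ofReal_norm, ← ofReal_norm]
    refine ENNReal.ofReal_le_ofReal (norm_sum_odot_le hC0.le hφ (fun t u => (hφp t u).trans (hC u))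
      hφf (fun f hf => ?_) hN hu)
    rw [← hΦ]
    exact Φ.unit_le_opNorm f ((f.norm_le zero_le_one).2 hf)

end NormEquality

/-! ### Lebesgue measure and reflection on the interval -/

section Interval

instance (T : ℝ) : IsFiniteMeasure (lebesgueIcc T) := by
  refine ⟨?_⟩
  rw [lebesgueIcc, (MeasurableEmbedding.subtype_coe measurableSet_Icc).comap_apply, image_univ,
    Subtype.range_coe]
  exact measure_Icc_lt_top

/-- The reflection `t ↦ T - t` of `[0,T]`. -/
def reflectIcc (T : ℝ) : Icc (0 : ℝ) T ≃ᵐ Icc (0 : ℝ) T where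
  toFun t := ⟨T - t, sub_nonneg.2 t.2.2, sub_le_self _ t.2.1⟩
  invFun t := ⟨T - t, sub_nonneg.2 t.2.2, sub_le_self _ t.2.1⟩
  left_inv t := Subtype.ext (sub_sub_cancel T t)
  right_inv t := Subtype.ext (sub_sub_cancel T t)
  measurable_toFun := (measurable_const.sub measurable_subtype_coe).subtype_mk
  measurable_invFun := (measurable_const.sub measurable_subtype_coe).subtype_mk

theorem continuous_reflectIcc (T : ℝ) : Continuous (reflectIcc T) :=
  (continuous_const.sub continuous_subtype_val).subtype_mk _

theorem measurePreserving_reflectIcc (T : ℝ) :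
    MeasurePreserving (reflectIcc T) (lebesgueIcc T) (lebesgueIcc T) := by
  have he : MeasurableEmbedding (Subtype.val : Icc (0 : ℝ) T → ℝ) :=
    MeasurableEmbedding.subtype_coe measurableSet_Icc
  refine ⟨(reflectIcc T).measurable, Measure.ext fun s hs => ?_⟩
  rw [Measure.map_apply (reflectIcc T).measurable hs, lebesgueIcc, he.comap_apply, he.comap_apply,
    ← (Measure.measurePreserving_sub_left volume T).measure_preimage
      (he.measurableSet_image' hs).nullMeasurableSet]
  congr 1
  ext x
  constructor
  · rintro ⟨t, ht, rfl⟩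
    exact ⟨reflectIcc T t, ht, rfl⟩
  · rintro ⟨t, ht, hx⟩
    refine ⟨reflectIcc T t, ?_, ?_⟩
    · have h : reflectIcc T (reflectIcc T t) = t := (reflectIcc T).left_inv t
      rwa [mem_preimage, h]
    · change T - (t : ℝ) = x
      rw [hx, sub_sub_cancel]

end Interval

/-! ### The input map -/

section InputMap

variable {𝕜 : Type*} [RCLike 𝕜] {X : Type*} [NormedAddCommGroup X] [NormedSpace 𝕜 X]
  [NormedSpace ℝ X] {U : Type*} [NormedAddCommGroup U] [NormedSpace 𝕜 U] [NormedSpace ℝ U]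
  {τX : SaksTopology 𝕜 X} {τU : SaksTopology 𝕜 U} {S : ℝ → X →L[𝕜] X} {B : U →L[𝕜] X} {T : ℝ}

/-- Testing on balls suffices in `U`; `B` sends a ball to a bounded set, where `τ_X`-convergence is
already `γ_X`-convergence. -/
theorem ContinuousOnBounded.continuous_mixed_seminorm_comp (hB : ContinuousOnBounded τU τX B)
    {p : Seminorm 𝕜 X} (hp : @Continuous X ℝ τX.mixed _ p) :
    @Continuous U ℝ τU.mixed _ (p.comp B.toLinearMap) := by
  obtain ⟨C, hC0, hC⟩ := p.bound_of_continuous_normedSpace (continuous_le_dom (norm_le_mixed τX) hp)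
  refine τU.continuous_mixed_of_continuousOn_bounded _ (C := C * ‖B‖) (fun u => ?_) fun r => ?_
  · rw [mul_assoc]
    exact (hC _).trans (mul_le_mul_of_nonneg_left (B.le_opNorm u) hC0.le)
  · rcases lt_or_ge r 0 with hr | hr
    · rw [Metric.closedBall_eq_empty.2 hr, @nhdsWithin_empty U τU.top]
      exact tendsto_bot
    have h1 : Tendsto B (@nhdsWithin U τU.top 0 (Metric.closedBall 0 r)) (@nhds X τX.top (B 0)) :=
      hB _ Metric.isBounded_closedBall 0 (Metric.mem_closedBall_self hr)
    have h2 : ∀ᶠ u in @nhdsWithin U τU.top 0 (Metric.closedBall 0 r), ‖B u‖ ≤ ‖B‖ * r := by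
      refine mem_of_superset (mem_inf_of_right (mem_principal_self _)) fun u hu => ?_
      exact B.le_opNorm_of_le (mem_closedBall_zero_iff.1 hu)
    have h3 := (@Continuous.tendsto X ℝ τX.mixed _ _ hp (B 0)).comp
      (τX.tendsto_mixed_of_tendsto_top h2 h1)
    rw [map_zero, map_zero] at h3
    exact h3

theorem Ctb.isBounded_range (u : Ctb τU T) : Bornology.IsBounded (range u.1) := by
  obtain ⟨-, C, hC⟩ := u.2
  refine isBounded_iff_forall_norm_le.2 ⟨C, ?_⟩
  rintro _ ⟨t, rfl⟩
  exact hC t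

theorem Ctb.continuous_mixed (u : Ctb τU T) : @Continuous _ U _ τU.mixed u.1 := by
  obtain ⟨hu, C, hC⟩ := u.2
  exact SaksTopology.continuous_mixed_of_continuous_top hu hC

theorem IsLocallyBiContinuous.exists_norm_inputIntegrand_le (hS : IsLocallyBiContinuous τX S)
    (B : U →L[𝕜] X) (u : Ctb τU T) : ∃ C, ∀ t, ‖inputIntegrand S B u.1 t‖ ≤ C := by
  obtain ⟨K, hK0, hK⟩ := hS.exists_norm_le T
  obtain ⟨C, hC⟩ := u.2.2
  refine ⟨K * (‖B‖ * C), fun t => ((S (T - t)).le_of_opNorm_le (hK _ (reflectIcc T t).2) _).trans ?_⟩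
  exact mul_le_mul_of_nonneg_left (B.le_opNorm_of_le (hC t)) hK0

/-- Sequences suffice on the interval, matching the sequential form of bi-equicontinuity. That
property handles the change of `B (u t)`, and strong continuity handles the change of time. -/
theorem IsLocallyBiContinuous.continuous_inputIntegrand (hS : IsLocallyBiContinuous τX S)
    (hB : ContinuousOnBounded τU τX B) (u : Ctb τU T) :
    @Continuous _ X _ τX.top (inputIntegrand S B u.1) := by
  have hg := τX.isTopologicalAddGroup
  refine (@continuous_iff_seqContinuous _ X _ τX.top _).2 fun t t₀ ht => ?_
  have hBu : @Continuous _ X _ τX.top (fun t => B (u.1 t)) :=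
    @ContinuousOn.comp_continuous _ U X _ τU.top τX.top _ _ _ (hB _ (Ctb.isBounded_range u)) u.2.1
      mem_range_self
  have hx : Tendsto (fun n => B (u.1 (t n))) atTop (@nhds X τX.top (B (u.1 t₀))) :=
    (@Continuous.tendsto _ X _ τX.top _ hBu t₀).comp ht
  have hb : Bornology.IsBounded (range fun n => B (u.1 (t n))) := by
    refine (B.lipschitz.isBounded_image (Ctb.isBounded_range u)).subset ?_
    rintro _ ⟨n, rfl⟩
    exact ⟨_, mem_range_self _, rfl⟩
  have h1 : Tendsto (fun n => S (T - t n) (B (u.1 (t n)) - B (u.1 t₀))) atTop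
      (@nhds X τX.top 0) := fun V hV => mem_map.2 <| by
    filter_upwards [hS.bi_equicontinuous _ _ hb hx T V hV] with n hn
    exact hn _ (reflectIcc T (t n)).2
  have h2 : Tendsto (fun n => S (T - t n) (B (u.1 t₀))) atTop
      (@nhds X τX.top (S (T - t₀) (B (u.1 t₀)))) := by
    refine Tendsto.comp (hS.continuous (B (u.1 t₀)) (T - t₀) (reflectIcc T t₀).2.1) ?_
    refine tendsto_nhdsWithin_iff.2 ⟨?_, Eventually.of_forall fun n => (reflectIcc T (t n)).2.1⟩
    exact (tendsto_const_nhds.sub ((continuous_subtype_val.tendsto t₀).comp ht))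
  let _ := τX.top
  have h3 := Filter.Tendsto.add h1 h2
  simp only [map_sub, sub_add_cancel, zero_add] at h3
  exact h3

theorem hasPettisIntegral_inputMap [CompleteSpace X] [IsScalarTower ℝ 𝕜 X]
    (hτ : τX.SeqComplete) (hS : IsLocallyBiContinuous τX S) (hB : ContinuousOnBounded τU τX B)
    (hT : 0 < T) (u : Ctb τU T) :
    HasPettisIntegral 𝕜 τX.mixed (lebesgueIcc T) (inputIntegrand S B u.1)
      (inputMap τX τU S B T u) := by
  have : Nonempty (Icc 0 T) := ⟨⟨0, le_rfl, hT.le⟩⟩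
  obtain ⟨C, hC⟩ := hS.exists_norm_inputIntegrand_le B u
  have h := hτ.exists_hasPettisIntegral (lebesgueIcc T) (hS.continuous_inputIntegrand hB u) hC
  rw [inputMap, pettisIntegral, dif_pos h]
  exact h.choose_spec

theorem IsLocallyBiContinuous.continuous_apply_orbit (hS : IsLocallyBiContinuous τX S)
    {x' : X →ₗ[𝕜] 𝕜} (hx' : @Continuous X 𝕜 τX.mixed _ x') (x : X) :
    Continuous fun t : Icc 0 T => x' (S t x) := by
  obtain ⟨K, -, hK⟩ := hS.exists_norm_le T
  have h : @Continuous (Icc 0 T) X _ τX.top fun t => S t x :=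
    @ContinuousOn.comp_continuous _ ℝ X _ _ τX.top _ _ _ (hS.continuous x) continuous_subtype_val
      fun t => t.2.1
  exact @Continuous.comp _ _ _ _ τX.mixed _ _ _ hx' (SaksTopology.continuous_mixed_of_continuous_top
    h fun t => (S t).le_of_opNorm_le (hK t t.2) x)

end InputMap

end BiCont

end

/-! ### The theorem -/

open BiCont in
theorem mainTheorem5 {𝕜 : Type*} [RCLike 𝕜]
    {X : Type*} [NormedAddCommGroup X] [NormedSpace 𝕜 X] [NormedSpace ℝ X] [IsScalarTower ℝ 𝕜 X]
    [CompleteSpace X]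
    {U : Type*} [NormedAddCommGroup U] [NormedSpace 𝕜 U] [NormedSpace ℝ U] [IsScalarTower ℝ 𝕜 U]
    [CompleteSpace U]
    (τX : BiCont.SaksTopology 𝕜 X) (hXcomplete : τX.SeqComplete) (hXseq : τX.CSequential)
    (τU : BiCont.SaksTopology 𝕜 U)
    (S : ℝ → X →L[𝕜] X) (hS : BiCont.IsLocallyBiContinuous τX S)
    (B : U →L[𝕜] X) (hB : BiCont.ContinuousOnBounded τU τX B)
    (T : ℝ) (hT : 0 < T) :
    -- the integral that defines the input map exists for every control function
    (∀ u : BiCont.Ctb τU T,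
      BiCont.HasPettisIntegral 𝕜 τX.mixed (BiCont.lebesgueIcc T)
        (BiCont.inputIntegrand S B u.1) (BiCont.inputMap τX τU S B T u)) ∧
    ∀ x' ∈ τX.sunDual,
      -- the integrals that define the measure exist
      (∀ u : U, Integrable
        (fun t : Icc (0 : ℝ) T => BiCont.dualOp B (BiCont.dualOp (S t) x') u) (BiCont.lebesgueIcc T)) ∧
      -- the measure and its time reversal belong to `M([0,T];U_γ')`
      BiCont.IsDualVectorMeasure τU.mixed (BiCont.odot
        (fun t : Icc (0 : ℝ) T => BiCont.dualOp B (BiCont.dualOp (S t) x')) (BiCont.lebesgueIcc T)) ∧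
      BiCont.IsDualVectorMeasure τU.mixed (BiCont.odot
        (fun t : Icc (0 : ℝ) T => BiCont.dualOp B (BiCont.dualOp (S (T - t)) x')) (BiCont.lebesgueIcc T)) ∧
      -- the dual input map takes values in the dual of `C_{τ,b}([0,T];U)` with respect to `γ_∞`
      IsLinearMap 𝕜 (BiCont.dualInputMap τX τU S B T x') ∧
      @Continuous (BiCont.Ctb τU T) 𝕜 (BiCont.gammaInf τU T) _
        (BiCont.dualInputMap τX τU S B T x') ∧
      -- it is integration against the time-reversed measure
      (∀ u : BiCont.Ctb τU T, BiCont.HasVectorIntegral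
        (BiCont.odot
          (fun t : Icc (0 : ℝ) T => BiCont.dualOp B (BiCont.dualOp (S (T - t)) x')) (BiCont.lebesgueIcc T))
        u.1 (BiCont.dualInputMap τX τU S B T x' u)) ∧
      -- its norm in the dual of `C([0,T];(U,‖·‖))` is the semivariation norm of the measure
      ∃ Φ : StrongDual 𝕜 C(Icc (0 : ℝ) T, U),
        (∀ u, Φ u = BiCont.dualInputMap τX τU S B T x' (BiCont.Ctb.ofContinuousMap τU u)) ∧
        ‖Φ‖ₑ = BiCont.semivariation (BiCont.odot
          (fun t : Icc (0 : ℝ) T => BiCont.dualOp B (BiCont.dualOp (S t) x')) (BiCont.lebesgueIcc T)) := by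
  have : Nonempty (Icc 0 T) := ⟨⟨0, le_rfl, hT.le⟩⟩
  refine ⟨hasPettisIntegral_inputMap hXcomplete hS hB hT, fun x' hx' => ?_⟩
  obtain ⟨p, hp, hSp⟩ := hXseq.exists_seminorm_orbit hS hx' hT.le
  -- Time zero in the orbit bound, where `S 0` is the identity, places `x'` in `X_γ'`; Pettis
  -- integrals can then be tested against it.
  have hx'c : @Continuous X 𝕜 τX.mixed _ x' :=
    @continuous_of_norm_le_seminorm 𝕜 X _ _ _ τX.mixed τX.mixed_isTopologicalAddGroup p hp x'
      x'.toLinearMap.isLinear 1 fun x => by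
        simpa [hS.map_zero] using hSp 0 ⟨le_rfl, hT.le⟩ x
  set μ := lebesgueIcc T
  let φ : Icc 0 T → StrongDual 𝕜 U := fun t => dualOp B (dualOp (S t) x')
  let ψ : Icc 0 T → StrongDual 𝕜 U := fun t => φ (reflectIcc T t)
  let q : Seminorm 𝕜 U := p.comp B.toLinearMap
  have hq : @Continuous U ℝ τU.mixed _ q := hB.continuous_mixed_seminorm_comp hp
  have hφq : ∀ t u, ‖φ t u‖ ≤ q u := fun t u => hSp t t.2 (B u)
  have hφc : ∀ u, Continuous fun t => φ t u := fun u =>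
    hS.continuous_apply_orbit (x' := x'.toLinearMap) hx'c (B u)
  have hφ : ∀ u, Integrable (fun t => φ t u) μ := fun u =>
    integrable_of_continuous_of_compactSpace (hφc u)
  have hψ : ∀ u, Integrable (fun t => ψ t u) μ := fun u =>
    integrable_of_continuous_of_compactSpace ((hφc u).comp (continuous_reflectIcc T))
  have hψq : ∀ t u, ‖ψ t u‖ ≤ q u := fun t u => hφq _ u
  have hpet := hasPettisIntegral_inputMap hXcomplete hS hB hT
  have hψu : ∀ u : Ctb τU T, Integrable (fun t => ψ t (u.1 t)) μ := fun u =>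
    (hpet u).integrable x'.toLinearMap hx'c
  have hD : ∀ u, dualInputMap τX τU S B T x' u = ∫ t, ψ t (u.1 t) ∂μ := fun u =>
    (hpet u).apply_eq x'.toLinearMap hx'c
  have hlin : IsLinearMap 𝕜 (dualInputMap τX τU S B T x') := by
    refine ⟨fun u v => ?_, fun c u => ?_⟩
    · rw [hD, hD, hD, ← integral_add (hψu u) (hψu v)]
      exact integral_congr_ae (Eventually.of_forall fun t => map_add (ψ t) _ _)
    · rw [hD, hD, ← integral_smul]
      exact integral_congr_ae (Eventually.of_forall fun t => map_smul (ψ t) _ _)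
  -- This one estimate yields both `γ_∞`-continuity and boundedness for the sup norm.
  have hbound : ∀ (u : Ctb τU T) (r : ℝ), (∀ t, q (u.1 t) ≤ r) →
      ‖dualInputMap τX τU S B T x' u‖ ≤ μ.real univ * r := fun u r hr => by
    rw [hD, mul_comm]
    exact norm_integral_le_of_norm_le_const
      (Eventually.of_forall fun t => (hψq t _).trans (hr t))
  have hgroup := τU.mixed_isTopologicalAddGroup
  refine ⟨hφ, isDualVectorMeasure_odot hgroup hq hφ hφq, isDualVectorMeasure_odot hgroup hq hψ hψq,
    hlin, ?_, fun u => ?_, ?_⟩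
  · have hw := @WithSeminorms.mk 𝕜 (Ctb τU T) _ _ _ _ (supSeminorm τU T) (gammaInf τU T) rfl
    exact @continuous_of_norm_le_seminorm 𝕜 (Ctb τU T) _ _ _ (gammaInf τU T)
      (@WithSeminorms.topologicalAddGroup _ _ _ _ _ _ (gammaInf τU T) _ hw)
      (supSeminorm τU T ⟨q, hq⟩)
      (@WithSeminorms.continuous_seminorm _ _ _ _ _ _ (gammaInf τU T) _ hw ⟨q, hq⟩) _ hlin
      (μ.real univ) fun u => hbound u _ fun t => le_ciSup (bddAbove_seminorm τU q hq u) t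
  · rw [hD]
    exact hasVectorIntegral_odot hgroup hq hψ hψq (Ctb.continuous_mixed u) (hψu u)
  · have hqn : Continuous q := continuous_le_dom (norm_le_mixed τU) hq
    obtain ⟨C, hC0, hC⟩ := q.bound_of_continuous_normedSpace hqn
    let Φ : StrongDual 𝕜 C(Icc 0 T, U) := LinearMap.mkContinuous
      { toFun := fun f => dualInputMap τX τU S B T x' (Ctb.ofContinuousMap τU f)
        map_add' := fun f g => hlin.map_add (Ctb.ofContinuousMap τU f) (Ctb.ofContinuousMap τU g)
        map_smul' := fun c f => hlin.map_smul c (Ctb.ofContinuousMap τU f) }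
      (μ.real univ * C) fun f => by
        rw [mul_assoc]
        exact hbound _ _ fun t => (hC _).trans
          (mul_le_mul_of_nonneg_left (f.norm_coe_le_norm t) hC0.le)
    refine ⟨Φ, fun f => rfl, ?_⟩
    -- The functional has the reversed density `ψ`; the measure-preserving reflection then replaces
    -- it by `φ`.
    rw [enorm_eq_semivariation_odot hqn hψ hψq (fun f => hψu (Ctb.ofContinuousMap τU f))
      fun f => hD (Ctb.ofContinuousMap τU f)]
    exact semivariation_odot_comp (reflectIcc T) (measurePreserving_reflectIcc T)
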